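/- Let $L$ be a homogeneous Lévy basis on $\mathbb{R}^2$ with characteristic triplet $(\gamma,b,\nu)$: a family of real random variables $L(A)$, indexed by the Borel sets $A\subseteq\mathbb{R}^2$ with $\mathrm{Leb}(A)<\infty$, such that $L\left(\bigcup_i A_i\right)=\sum_i L(A_i)$ almost surely for every sequence of pairwise disjoint Borel sets whose union has finite Lebesgue measure, such that $L(A_1),L(A_2),\dots$ are independent whenever $A_1,A_2,\dots$ are pairwise disjoint, and such that $\mathbb{E}\,e^{izL(A)}=e^{\mathrm{Leb}(A)\psi(z)}$ for all $z\in\mathbb{R}$, where $$\psi(z)=i\gamma z-\tfrac12 b^2z^2+\int_{\mathbb{R}}\left(e^{izx}-1-izx\mathbf 1_{|x|\le1}\right)\nu(\mathrm{d}x),$$ with $\gamma\in\mathbb{R}$, $b\ge0$, $\nu(\{0\})=0$ and $\int(1\wedge x^2)\,\nu(\mathrm{d}x)<\infty$. Let the Lévy seed $L'$ be a random variable with $\mathbb{E}\,e^{izL'}=e^{\psi(z)}$, and assume that $\mathrm{Var}(L')=1$ and $\mathbb{E}|L'|^{p_0}<\infty$ for some $p_0\ge16/3$. Let $a:[0,\infty)\to[0,\infty)$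 be a continuous, non-increasing, integrable function of the form $a(s)=\int_s^\infty\phi(y)\,\mathrm{d}y$ for $s\ge0$, where $\phi$ is continuous and strictly positive on $[0,\infty)$ and $\phi(s)=O(s^{-\alpha-1})$ as $s\to\infty$ for some $\alpha>1$. Let $X_t=L(A_t)$ be the trawl process, where $A_t=A+(t,0)$ and $A=\{(r,y):r\le0,\ 0\le y\le a(-r)\}$. Let $\Delta_n>0$ satisfy $\Delta_n\to0$, $n\Delta_n\to\infty$ and $n\Delta_n^3\to\mu$ for some $\mu\in[0,\infty]$. Put $\delta_kX=X_{(k+1)\Delta_n}-X_{k\Delta_n}$ and, for $t\ge0$, $$\hat a'(t)=\frac{1}{n\Delta_n^2}\sum_{k=l+1}^{n-2}\delta_kX\cdot\delta_{k-l-1}X,\qquad l=\lfloor t/\Delta_n\rfloor .$$ Then for every $t\ge0$ the function $a$ is differentiable at $t$ (from the right if $t=0$), and, as $n\to\infty$, $$\hat a'(t)=a'(t)+O_{\mathbb P}\left(1/\sqrt{n\Delta_n^2}\right)+o(1),$$ where the $o(1)$ term is a deterministic sequence. Consequently, if $n\Delta_n^2\to\infty$, then $\hat a'(t)\to a'(t)$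 in probability. -/

import Mathlib

open MeasureTheory ProbabilityTheory Filter Topology Asymptotics
open scoped ENNReal

noncomputable section

/-- A characteristic triplet `(γ, b, ν)`: a real drift, a Gaussian coefficient `b ≥ 0`, and a Lévy
measure `ν`, that is `ν({0}) = 0` and `∫ min(1, x²) ν(dx) < ∞`. -/
structure LevyTriplet where
  drift : ℝ
  gauss : ℝ
  levyMeasure : Measure ℝ
  gauss_nonneg : 0 ≤ gauss
  levyMeasure_zero : levyMeasure {0} = 0
  lintegral_lt_top : ∫⁻ x, ENNReal.ofReal (min 1 (x ^ 2)) ∂levyMeasure < ∞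

/-- The characteristic exponent
`ψ(z) = iγz - b²z²/2 + ∫ (exp(izx) - 1 - izx 1_{|x| ≤ 1}) ν(dx)`. -/
def LevyTriplet.exponent (T : LevyTriplet) (z : ℝ) : ℂ :=
  Complex.I * T.drift * z - (1 / 2) * (T.gauss : ℂ) ^ 2 * (z : ℂ) ^ 2
    + ∫ x : ℝ, (Complex.exp (Complex.I * z * x) - 1
        - (if |x| ≤ 1 then Complex.I * z * x else 0)) ∂T.levyMeasure

/-- `κ` is the law of the Lévy seed of the triplet `T`: the infinitely divisible distribution on
`ℝ` whose characteristic function is `exp ψ`. -/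
def IsLevySeedLaw (T : LevyTriplet) (κ : Measure ℝ) : Prop :=
  IsProbabilityMeasure κ ∧ ∀ z : ℝ, charFun κ z = Complex.exp (T.exponent z)

/-- `L = {L(A)}` is a homogeneous Lévy basis on `ℝ²` with characteristic triplet `T`, indexed by
the Borel sets of finite Lebesgue measure (the values of `L` at other sets are irrelevant). The
series in `sigma_additive` converges almost surely through its partial sums; it need not converge
absolutely. Infinite divisibility of each `L(A)` is contained in the form of its characteristic
function. -/
structure IsHomogeneousLevyBasis {Ω : Type*} [MeasurableSpace Ω] (P : Measure Ω)
    (T : LevyTriplet) (L : Set (ℝ × ℝ) → Ω → ℝ) : Prop where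
  measurable : ∀ A : Set (ℝ × ℝ), MeasurableSet A → volume A < ∞ → Measurable (L A)
  sigma_additive : ∀ A : ℕ → Set (ℝ × ℝ), (∀ i, MeasurableSet (A i)) →
    Pairwise (fun i j => Disjoint (A i) (A j)) → volume (⋃ i, A i) < ∞ →
    ∀ᵐ ω ∂P, Tendsto (fun m : ℕ => ∑ i ∈ Finset.range m, L (A i) ω) atTop
      (𝓝 (L (⋃ i, A i) ω))
  independently_scattered : ∀ A : ℕ → Set (ℝ × ℝ), (∀ i, MeasurableSet (A i)) →
    (∀ i, volume (A i) < ∞) → Pairwise (fun i j => Disjoint (A i) (A j)) →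
    iIndepFun (fun i => L (A i)) P
  charFun_eq : ∀ A : Set (ℝ × ℝ), MeasurableSet A → volume A < ∞ →
    ∀ z : ℝ, charFun (P.map (L A)) z = Complex.exp ((volume A).toReal * T.exponent z)

/-- A trawl function on `[0, ∞)`; the values of `a` on the negative half-line are irrelevant. -/
structure IsTrawlFunction (a : ℝ → ℝ) : Prop where
  nonneg : ∀ s, 0 ≤ s → 0 ≤ a s
  continuousOn : ContinuousOn a (Set.Ici 0)
  antitoneOn : AntitoneOn a (Set.Ici 0)
  integrableOn : IntegrableOn a (Set.Ici 0)

/-- The trawl set `A = {(r, y) : r ≤ 0, 0 ≤ y ≤ a(-r)}`. -/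
def trawlSet (a : ℝ → ℝ) : Set (ℝ × ℝ) :=
  {p | p.1 ≤ 0 ∧ 0 ≤ p.2 ∧ p.2 ≤ a (-p.1)}

/-- The translated trawl set `A_t = A + (t, 0)`. -/
def trawlSetAt (a : ℝ → ℝ) (t : ℝ) : Set (ℝ × ℝ) :=
  {p | p - (t, 0) ∈ trawlSet a}

/-- The trawl process `X_t = L(A_t)`. -/
def trawlProcess {Ω : Type*} (L : Set (ℝ × ℝ) → Ω → ℝ) (a : ℝ → ℝ) (t : ℝ) : Ω → ℝ :=
  L (trawlSetAt a t)

/-- The increment `δ_k X = X_{(k+1)Δ} - X_{kΔ}`. -/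
def gridIncrement {Ω : Type*} (X : ℝ → Ω → ℝ) (Δ : ℝ) (k : ℕ) (ω : Ω) : ℝ :=
  X ((k + 1) * Δ) ω - X (k * Δ) ω

/-- The derivative estimator
`(nΔ²)⁻¹ ∑_{k=l+1}^{n-2} δ_k X · δ_{k-l-1} X`, where `lΔ ≤ t < (l+1)Δ`.
(For `n ≤ 1` the sum is empty also with the truncated subtraction.) -/
def derivEstimator {Ω : Type*} (X : ℝ → Ω → ℝ) (Δ : ℝ) (n : ℕ) (t : ℝ) (ω : Ω) : ℝ :=
  1 / (n * Δ ^ 2) * ∑ k ∈ Finset.Icc (⌊t / Δ⌋₊ + 1) (n - 2),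
    gridIncrement X Δ k ω * gridIncrement X Δ (k - ⌊t / Δ⌋₊ - 1) ω

/-- `Y_n = O_P(r_n)` as `n → ∞`: for every `ε > 0` there is `M` with `P(|Y_n| > M r_n) ≤ ε` for all
large `n`. -/
def IsBigOInProbability {Ω : Type*} [MeasurableSpace Ω] (P : Measure Ω)
    (Y : ℕ → Ω → ℝ) (r : ℕ → ℝ) : Prop :=
  ∀ ε : ℝ, 0 < ε → ∃ M : ℝ, 0 < M ∧
    ∀ᶠ n in atTop, P {ω | M * r n < |Y n ω|} ≤ ENNReal.ofReal ε

/-- The sampling scheme: `Δ_n > 0`, `Δ_n → 0`, `n Δ_n → ∞`, and `n Δ_n³ → μ ∈ [0, ∞]`. -/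
structure SamplingScheme (Δ : ℕ → ℝ) (μ : ℝ≥0∞) : Prop where
  pos : ∀ n, 0 < Δ n
  tendsto_zero : Tendsto Δ atTop (𝓝 0)
  tendsto_span : Tendsto (fun n : ℕ => n * Δ n) atTop atTop
  tendsto_cube : Tendsto (fun n : ℕ => ENNReal.ofReal (n * Δ n ^ 3)) atTop (𝓝 μ)

/-- `a(s) = ∫_s^∞ φ(y) dy` for `s ≥ 0`, with `φ` strictly positive and continuous on `[0, ∞)` and
`φ(s) = O(s^{-α-1})` as `s → ∞` for some `α > 1`. -/
structure HasTrawlDensity (a φ : ℝ → ℝ) : Prop where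
  pos : ∀ s, 0 ≤ s → 0 < φ s
  continuousOn : ContinuousOn φ (Set.Ici 0)
  decay : ∃ α : ℝ, 1 < α ∧ φ =O[atTop] fun s : ℝ => s ^ (-α - 1)
  eq_integral : ∀ s, 0 ≤ s → a s = ∫ y in Set.Ioi s, φ y

/-- The moment assumption on the law `κ` of the Lévy seed: unit variance and a finite absolute
moment of some order `p₀ ≥ 16/3`. -/
def SeedMoments (κ : Measure ℝ) : Prop :=
  Var[id; κ] = 1 ∧ ∃ p₀ : ℝ, 16 / 3 ≤ p₀ ∧ Integrable (fun x : ℝ => |x| ^ p₀) κ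

end

/-! The derivative of `a` is visible in a second difference of the trawl sets. Centred values of `L`
on disjoint sets are independent, with variance equal to area, so covariances of increments are
signed areas. With lag `j = l + 1`, a point contributes to both `δ_k X` and `δ_{k-j} X` exactly when
it enters the moving trawl set during step `k - j` and leaves it during step `k`. Such points fill a
region of area `∫ (a(x) - a(x + Δ)) dx` over `lΔ ≤ x ≤ (l+1)Δ`, which is `φ(t)Δ²` up to `o(Δ²)`, and
they carry the sign `-1` (`cellCov_lag`, `exists_cell_volume_bounds`). The mean of the estimator
therefore tends to `-φ(t) = a'(t)`; the summands lost to the lag number at most `2 + t/Δ` out of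
`n`, a vanishing proportion because `nΔ → ∞` (`tendsto_derivEstimatorMean`).

For the fluctuation, Chebyshev's inequality reduces the claim to a variance `O(nΔ²)` for the
unnormalised sum. The plane is cut into cells according to the first and last grid times at which a
point lies in the trawl set. All increments become combinations, with coefficients in `{-1, 0, 1}`,
of the same independent centred variables (`ae_gridIncrement`). A fourth moment of such combinations
is the sum over the three pairings plus a fourth-cumulant term (`integral_mul_four_linear_comb`),
and the fourth cumulant of `L(A)` is proportional to the area of `A` (`exists_fourth_cumulant`). One
pairing cancels against the squared mean. In the other two, one covariance is `O(Δ)` and the other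
is `O(Δ)` even after summation over all increments. The cumulant term survives only on the diagonal,
where it is `O(Δ²)`. This gives `variance_sum_le`. -/

set_option linter.unusedSectionVars false

noncomputable section

/-! ### Moments of linear combinations of independent centred variables -/

section Abstract

/-- An additive function on `[0, ∞)` which is bounded on `[0, 1]` is linear. -/
lemma eq_mul_of_additive_of_bounded {f : ℝ → ℝ} {B : ℝ}
    (hadd : ∀ s u, 0 ≤ s → 0 ≤ u → f (s + u) = f s + f u)
    (hB : ∀ s, 0 ≤ s → s ≤ 1 → |f s| ≤ B) {s : ℝ} (hs : 0 ≤ s) : f s = s * f 1 := by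
  have h0 : f 0 = 0 := by
    have := hadd 0 0 le_rfl le_rfl
    simp only [add_zero] at this
    linarith
  have hnat : ∀ (n : ℕ) (x : ℝ), 0 ≤ x → f (n * x) = n * f x := by
    intro n x hx
    induction n with
    | zero => simp [h0]
    | succ n ih =>
      have : ((n + 1 : ℕ) : ℝ) * x = n * x + x := by push_cast; ring
      rw [this, hadd _ _ (by positivity) hx, ih]
      push_cast; ring
  -- Additivity along the integer part reduces the deviation from linearity to `[0, 1]`, so it is
  -- bounded on the whole half-line.
  have key : ∀ x, 0 ≤ x → |f x - x * f 1| ≤ B + |f 1| := by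
    intro x hx
    have h1 : f x = ⌊x⌋₊ * f 1 + f (x - ⌊x⌋₊) := by
      have h2 := hnat ⌊x⌋₊ 1 zero_le_one
      have h3 := hadd (⌊x⌋₊ * 1) (x - ⌊x⌋₊) (by positivity)
        (sub_nonneg.2 (Nat.floor_le hx))
      rw [h2] at h3
      rw [← h3]; congr 1; ring
    have h4 : 0 ≤ x - ⌊x⌋₊ := sub_nonneg.2 (Nat.floor_le hx)
    have h5 : x - ⌊x⌋₊ ≤ 1 := by linarith [Nat.lt_floor_add_one x]
    have h6 : f x - x * f 1 = f (x - ⌊x⌋₊) - (x - ⌊x⌋₊) * f 1 := by rw [h1]; ring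
    rw [h6]
    refine (abs_sub _ _).trans (add_le_add (hB _ h4 h5) ?_)
    rw [abs_mul, abs_of_nonneg h4]
    exact mul_le_of_le_one_left (abs_nonneg _) h5
  by_contra hne
  have hpos : 0 < |f s - s * f 1| := abs_pos.2 (sub_ne_zero.2 hne)
  -- The deviation is multiplied by `n` when `s` is replaced by `n * s`, so a nonzero deviation
  -- would be unbounded.
  obtain ⟨n, hn⟩ := exists_nat_gt ((B + |f 1|) / |f s - s * f 1|)
  have h1 := key (n * s) (by positivity)
  rw [hnat n s hs, mul_assoc, ← mul_sub, abs_mul, Nat.abs_cast] at h1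
  rw [div_lt_iff₀ hpos] at hn
  linarith

variable {Ω : Type*} [MeasurableSpace Ω] {P : Measure Ω} [IsProbabilityMeasure P]

lemma integrable_mul_four {A B C D : Ω → ℝ} (hA : MemLp A 4 P) (hB : MemLp B 4 P)
    (hC : MemLp C 4 P) (hD : MemLp D 4 P) :
    Integrable (fun ω => A ω * B ω * C ω * D ω) P := by
  have : ENNReal.HolderTriple 4 4 2 := ⟨by
    rw [show (4 : ℝ≥0∞) = 2 * 2 by norm_num, ENNReal.mul_inv (by simp) (by simp), ← mul_add,
      ENNReal.inv_two_add_inv_two, mul_one]⟩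
  have h1 : MemLp (fun ω => A ω * B ω) 2 P := hB.mul hA
  have h2 : MemLp (fun ω => C ω * D ω) 2 P := hD.mul hC
  have := h1.integrable_mul h2
  refine this.congr (Eventually.of_forall fun ω => ?_)
  simp only [Pi.mul_apply]; ring

lemma integrable_mul_three {A B C : Ω → ℝ} (hA : MemLp A 4 P) (hB : MemLp B 4 P)
    (hC : MemLp C 4 P) : Integrable (fun ω => A ω * B ω * C ω) P := by
  simpa using integrable_mul_four hA hB hC (memLp_const (1 : ℝ))

lemma integrable_mul_two {A B : Ω → ℝ} (hA : MemLp A 4 P) (hB : MemLp B 4 P) :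
    Integrable (fun ω => A ω * B ω) P := by
  simpa using integrable_mul_three hA hB (memLp_const (1 : ℝ))

lemma integrable_of_memLp_four {A : Ω → ℝ} (hA : MemLp A 4 P) : Integrable A P :=
  hA.integrable (by norm_num)

/-- Adding an independent centred summand to two centred variables. -/
lemma integral_mul_add_indep {A B ξ : Ω → ℝ} (hA : MemLp A 4 P) (hB : MemLp B 4 P)
    (hξ : MemLp ξ 4 P) (hind : IndepFun (fun ω => (A ω, B ω)) ξ P) (hξ0 : ∫ ω, ξ ω ∂P = 0)
    (a b : ℝ) :
    ∫ ω, (A ω + a * ξ ω) * (B ω + b * ξ ω) ∂P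
      = ∫ ω, A ω * B ω ∂P + a * b * ∫ ω, ξ ω ^ 2 ∂P := by
  have i1 := integrable_mul_two hA hB
  have i2 : Integrable (fun ω => ξ ω * (a * B ω + b * A ω)) P := by
    refine (((integrable_mul_two hξ hB).const_mul a).fun_add
      ((integrable_mul_two hξ hA).const_mul b)).congr (Eventually.of_forall fun ω => ?_)
    ring
  have i3 : Integrable (fun ω => (a * b) * ξ ω ^ 2) P := by
    refine Integrable.const_mul ?_ _
    simpa only [pow_two] using integrable_mul_two hξ hξ
  have e : ∀ ω, (A ω + a * ξ ω) * (B ω + b * ξ ω)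
      = A ω * B ω + ξ ω * (a * B ω + b * A ω) + (a * b) * ξ ω ^ 2 := fun ω => by ring
  have e2 : ∫ ω, ξ ω * (a * B ω + b * A ω) ∂P = 0 := by
    have hi : IndepFun ξ (fun ω => a * B ω + b * A ω) P :=
      (hind.comp (φ := fun q : ℝ × ℝ => a * q.2 + b * q.1) (ψ := id) (by fun_prop)
        measurable_id).symm
    rw [hi.integral_fun_mul_eq_mul_integral hξ.aestronglyMeasurable
      ((hB.const_mul a).add (hA.const_mul b)).aestronglyMeasurable, hξ0, zero_mul]
  simp only [e]
  rw [integral_add (i1.fun_add i2) i3, integral_add i1 i2, e2, integral_const_mul, add_zero]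

/-- Adding an independent centred summand to four centred variables. -/
lemma integral_mul_four_add_indep {A B C D ξ : Ω → ℝ} (hA : MemLp A 4 P) (hB : MemLp B 4 P)
    (hC : MemLp C 4 P) (hD : MemLp D 4 P) (hξ : MemLp ξ 4 P)
    (hind : IndepFun (fun ω => (A ω, B ω, C ω, D ω)) ξ P) (hξ0 : ∫ ω, ξ ω ∂P = 0)
    (hA0 : ∫ ω, A ω ∂P = 0) (hB0 : ∫ ω, B ω ∂P = 0) (hC0 : ∫ ω, C ω ∂P = 0)
    (hD0 : ∫ ω, D ω ∂P = 0) (a b c d : ℝ) :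
    ∫ ω, (A ω + a * ξ ω) * (B ω + b * ξ ω) * (C ω + c * ξ ω) * (D ω + d * ξ ω) ∂P
      = ∫ ω, A ω * B ω * C ω * D ω ∂P
        + (∫ ω, ξ ω ^ 2 ∂P) * (a * b * (∫ ω, C ω * D ω ∂P) + a * c * (∫ ω, B ω * D ω ∂P)
          + a * d * (∫ ω, B ω * C ω ∂P) + b * c * (∫ ω, A ω * D ω ∂P)
          + b * d * (∫ ω, A ω * C ω ∂P) + c * d * (∫ ω, A ω * B ω ∂P))
        + a * b * c * d * ∫ ω, ξ ω ^ 4 ∂P := by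
  -- `T1`, `T2`, `T3` are the coefficients of `ξ`, `ξ²`, `ξ³` in the expanded product. The first
  -- contributes nothing since `ξ` is centred, the third since `A`, `B`, `C`, `D` are.
  set T1 : ℝ × ℝ × ℝ × ℝ → ℝ := fun q => a * (q.2.1 * q.2.2.1 * q.2.2.2)
    + b * (q.1 * q.2.2.1 * q.2.2.2) + c * (q.1 * q.2.1 * q.2.2.2) + d * (q.1 * q.2.1 * q.2.2.1)
    with hT1
  set T2 : ℝ × ℝ × ℝ × ℝ → ℝ := fun q => a * b * (q.2.2.1 * q.2.2.2) + a * c * (q.2.1 * q.2.2.2)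
    + a * d * (q.2.1 * q.2.2.1) + b * c * (q.1 * q.2.2.2) + b * d * (q.1 * q.2.2.1)
    + c * d * (q.1 * q.2.1) with hT2
  set T3 : ℝ × ℝ × ℝ × ℝ → ℝ := fun q => b * c * d * q.1 + a * c * d * q.2.1
    + a * b * d * q.2.2.1 + a * b * c * q.2.2.2 with hT3
  set Z : Ω → ℝ × ℝ × ℝ × ℝ := fun ω => (A ω, B ω, C ω, D ω) with hZ
  have iT1 : Integrable (fun ω => T1 (Z ω)) P :=
    ((((integrable_mul_three hB hC hD).const_mul a).add
      ((integrable_mul_three hA hC hD).const_mul b)).add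
      ((integrable_mul_three hA hB hD).const_mul c)).add
      ((integrable_mul_three hA hB hC).const_mul d)
  have iAB := (integrable_mul_two hA hB).const_mul (c * d)
  have iAC := (integrable_mul_two hA hC).const_mul (b * d)
  have iAD := (integrable_mul_two hA hD).const_mul (b * c)
  have iBC := (integrable_mul_two hB hC).const_mul (a * d)
  have iBD := (integrable_mul_two hB hD).const_mul (a * c)
  have iCD := (integrable_mul_two hC hD).const_mul (a * b)
  have iT2 : Integrable (fun ω => T2 (Z ω)) P :=
    ((((iCD.fun_add iBD).fun_add iBC).fun_add iAD).fun_add iAC).fun_add iAB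
  have iA := (integrable_of_memLp_four hA).const_mul (b * c * d)
  have iB := (integrable_of_memLp_four hB).const_mul (a * c * d)
  have iC := (integrable_of_memLp_four hC).const_mul (a * b * d)
  have iD := (integrable_of_memLp_four hD).const_mul (a * b * c)
  have iT3 : Integrable (fun ω => T3 (Z ω)) P := ((iA.fun_add iB).fun_add iC).fun_add iD
  have iξ1 : Integrable (fun ω => ξ ω) P := integrable_of_memLp_four hξ
  have iξ2 : Integrable (fun ω => ξ ω ^ 2) P := by
    simpa only [pow_two] using integrable_mul_two hξ hξ
  have iξ3 : Integrable (fun ω => ξ ω ^ 3) P := by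
    convert integrable_mul_three hξ hξ hξ using 2; ring
  have iξ4 : Integrable (fun ω => ξ ω ^ 4) P := by
    convert integrable_mul_four hξ hξ hξ hξ using 2; ring
  have mT1 : Measurable T1 := by rw [hT1]; fun_prop
  have mT2 : Measurable T2 := by rw [hT2]; fun_prop
  have mT3 : Measurable T3 := by rw [hT3]; fun_prop
  have I1 : IndepFun (fun ω => ξ ω) (fun ω => T1 (Z ω)) P :=
    (hind.comp (ψ := id) mT1 measurable_id).symm
  have I2 : IndepFun (fun ω => ξ ω ^ 2) (fun ω => T2 (Z ω)) P :=
    (hind.comp (ψ := fun x => x ^ 2) mT2 (by fun_prop)).symm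
  have I3 : IndepFun (fun ω => ξ ω ^ 3) (fun ω => T3 (Z ω)) P :=
    (hind.comp (ψ := fun x => x ^ 3) mT3 (by fun_prop)).symm
  have j0 := integrable_mul_four hA hB hC hD
  have j1 : Integrable (fun ω => ξ ω * T1 (Z ω)) P := I1.integrable_mul iξ1 iT1
  have j2 : Integrable (fun ω => ξ ω ^ 2 * T2 (Z ω)) P := I2.integrable_mul iξ2 iT2
  have j3 : Integrable (fun ω => ξ ω ^ 3 * T3 (Z ω)) P := I3.integrable_mul iξ3 iT3
  have j4 := iξ4.const_mul (a * b * c * d)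
  have e : ∀ ω, (A ω + a * ξ ω) * (B ω + b * ξ ω) * (C ω + c * ξ ω) * (D ω + d * ξ ω)
      = A ω * B ω * C ω * D ω + ξ ω * T1 (Z ω) + ξ ω ^ 2 * T2 (Z ω) + ξ ω ^ 3 * T3 (Z ω)
        + a * b * c * d * ξ ω ^ 4 := fun ω => by
    simp only [hT1, hT2, hT3, hZ]; ring
  have E2 : ∫ ω, T2 (Z ω) ∂P = a * b * (∫ ω, C ω * D ω ∂P) + a * c * (∫ ω, B ω * D ω ∂P)
          + a * d * (∫ ω, B ω * C ω ∂P) + b * c * (∫ ω, A ω * D ω ∂P)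
          + b * d * (∫ ω, A ω * C ω ∂P) + c * d * (∫ ω, A ω * B ω ∂P) := by
    simp only [hT2, hZ]
    rw [integral_add ((((iCD.fun_add iBD).fun_add iBC).fun_add iAD).fun_add iAC) iAB,
      integral_add (((iCD.fun_add iBD).fun_add iBC).fun_add iAD) iAC,
      integral_add ((iCD.fun_add iBD).fun_add iBC) iAD, integral_add (iCD.fun_add iBD) iBC,
      integral_add iCD iBD]
    simp only [integral_const_mul]
  have E3 : ∫ ω, T3 (Z ω) ∂P = 0 := by
    simp only [hT3, hZ]
    rw [integral_add ((iA.fun_add iB).fun_add iC) iD, integral_add (iA.fun_add iB) iC, integral_add iA iB]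
    simp only [integral_const_mul, hA0, hB0, hC0, hD0, mul_zero, add_zero]
  simp only [e]
  rw [integral_add (((j0.fun_add j1).fun_add j2).fun_add j3) j4, integral_add ((j0.fun_add j1).fun_add j2) j3,
    integral_add (j0.fun_add j1) j2, integral_add j0 j1,
    I1.integral_fun_mul_eq_mul_integral iξ1.aestronglyMeasurable iT1.aestronglyMeasurable,
    I2.integral_fun_mul_eq_mul_integral iξ2.aestronglyMeasurable iT2.aestronglyMeasurable,
    I3.integral_fun_mul_eq_mul_integral iξ3.aestronglyMeasurable iT3.aestronglyMeasurable,
    hξ0, E2, E3, integral_const_mul]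
  ring

variable {ι : Type*} [DecidableEq ι]

lemma memLp_linear_comb {ξ : ι → Ω → ℝ} (hL : ∀ i, MemLp (ξ i) 4 P) (s : Finset ι) (f : ι → ℝ) :
    MemLp (fun ω => ∑ i ∈ s, f i * ξ i ω) 4 P :=
  memLp_finsetSum s fun i _ => (hL i).const_mul (f i)

lemma integral_linear_comb {ξ : ι → Ω → ℝ} (hL : ∀ i, MemLp (ξ i) 4 P)
    (h0 : ∀ i, ∫ ω, ξ i ω ∂P = 0) (s : Finset ι) (f : ι → ℝ) :
    ∫ ω, ∑ i ∈ s, f i * ξ i ω ∂P = 0 := by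
  rw [integral_finsetSum _ fun i _ => (integrable_of_memLp_four (hL i)).const_mul (f i)]
  simp [integral_const_mul, h0]

/-- The general target of `G` allows pairs and quadruples of linear combinations to be jointly
independent of the next variable, as the inductions on the index set require. -/
lemma indepFun_linear_comb {ξ : ι → Ω → ℝ} (hm : ∀ i, Measurable (ξ i)) (hi : iIndepFun ξ P)
    {s : Finset ι} {j : ι} (hj : j ∉ s) {β : Type*} [MeasurableSpace β]
    (G : (s → ℝ) → β) (hG : Measurable G) :
    IndepFun (fun ω => G (fun i => ξ i ω)) (ξ j) P := by
  have h := hi.indepFun_finset s {j} (by simpa using hj) hm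
  exact h.comp (ψ := fun q : (({j} : Finset ι) → ℝ) => q ⟨j, Finset.mem_singleton_self j⟩) hG
    (measurable_pi_apply _)

/-- Second moments of linear combinations of independent centred variables. -/
lemma integral_mul_linear_comb {ξ : ι → Ω → ℝ} (hm : ∀ i, Measurable (ξ i))
    (hi : iIndepFun ξ P) (hL : ∀ i, MemLp (ξ i) 4 P) (h0 : ∀ i, ∫ ω, ξ i ω ∂P = 0)
    (s : Finset ι) (f g : ι → ℝ) :
    ∫ ω, (∑ i ∈ s, f i * ξ i ω) * (∑ i ∈ s, g i * ξ i ω) ∂P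
      = ∑ i ∈ s, f i * g i * ∫ ω, ξ i ω ^ 2 ∂P := by
  induction s using Finset.induction_on with
  | empty => simp
  | insert j s hj ih =>
    simp only [Finset.sum_insert hj]
    rw [← ih, add_comm (f j * g j * _), ← integral_mul_add_indep (memLp_linear_comb hL s f)
      (memLp_linear_comb hL s g) (hL j) ?_ (h0 j)]
    · simp only [add_comm]
    · have := indepFun_linear_comb hm hi hj
        (fun q : s → ℝ => (∑ i : s, f i * q i, ∑ i : s, g i * q i)) (by fun_prop)
      convert this using 3 <;> exact (Finset.sum_coe_sort s (fun i => _ * ξ i _)).symm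

/-- Fourth moments of linear combinations of independent centred variables. -/
lemma integral_mul_four_linear_comb {ξ : ι → Ω → ℝ} (hm : ∀ i, Measurable (ξ i))
    (hi : iIndepFun ξ P) (hL : ∀ i, MemLp (ξ i) 4 P) (h0 : ∀ i, ∫ ω, ξ i ω ∂P = 0)
    (s : Finset ι) (f g h k : ι → ℝ) :
    ∫ ω, (∑ i ∈ s, f i * ξ i ω) * (∑ i ∈ s, g i * ξ i ω) * (∑ i ∈ s, h i * ξ i ω)
        * (∑ i ∈ s, k i * ξ i ω) ∂P
      = (∑ i ∈ s, f i * g i * ∫ ω, ξ i ω ^ 2 ∂P) * (∑ i ∈ s, h i * k i * ∫ ω, ξ i ω ^ 2 ∂P)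
        + (∑ i ∈ s, f i * h i * ∫ ω, ξ i ω ^ 2 ∂P) * (∑ i ∈ s, g i * k i * ∫ ω, ξ i ω ^ 2 ∂P)
        + (∑ i ∈ s, f i * k i * ∫ ω, ξ i ω ^ 2 ∂P) * (∑ i ∈ s, g i * h i * ∫ ω, ξ i ω ^ 2 ∂P)
        + ∑ i ∈ s, f i * g i * h i * k i
            * (∫ ω, ξ i ω ^ 4 ∂P - 3 * (∫ ω, ξ i ω ^ 2 ∂P) ^ 2) := by
  induction s using Finset.induction_on with
  | empty => simp
  | insert j s hj ih =>
    have step := integral_mul_four_add_indep (memLp_linear_comb hL s f) (memLp_linear_comb hL s g)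
      (memLp_linear_comb hL s h) (memLp_linear_comb hL s k) (hL j) (P := P) (by
        have := indepFun_linear_comb hm hi hj
          (fun q : s → ℝ => (∑ i : s, f i * q i, ∑ i : s, g i * q i, ∑ i : s, h i * q i,
            ∑ i : s, k i * q i)) (by fun_prop)
        convert this using 3
        · exact (Finset.sum_coe_sort s (fun i => _ * ξ i _)).symm
        · exact congrArg₂ Prod.mk (Finset.sum_coe_sort s (fun i => _ * ξ i _)).symm
            (congrArg₂ Prod.mk (Finset.sum_coe_sort s (fun i => _ * ξ i _)).symm
              (Finset.sum_coe_sort s (fun i => _ * ξ i _)).symm)) (h0 j)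
      (integral_linear_comb hL h0 s f) (integral_linear_comb hL h0 s g)
      (integral_linear_comb hL h0 s h) (integral_linear_comb hL h0 s k) (f j) (g j) (h j) (k j)
    simp only [integral_mul_linear_comb hm hi hL h0, ih] at step
    simp only [Finset.sum_insert hj]
    have e : ∀ x y : ℝ, x + y = y + x := add_comm
    simp only [e (_ * ξ j _)]
    rw [step]
    ring

/-- If a sum of two independent variables is in `L⁴`, so is the first summand. -/
lemma memLp_of_indepFun_add {X Y : Ω → ℝ} (hX : Measurable X) (hY : Measurable Y)
    (hind : IndepFun X Y P) (h : MemLp (fun ω => X ω + Y ω) 4 P) : MemLp X 4 P := by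
  have hm := (indepFun_iff_map_prod_eq_prod_map_map hX.aemeasurable hY.aemeasurable).1 hind
  have := Measure.isProbabilityMeasure_map (μ := P) hX.aemeasurable
  have := Measure.isProbabilityMeasure_map (μ := P) hY.aemeasurable
  have h1 : Integrable (fun ω => ‖X ω + Y ω‖ ^ (4 : ℝ)) P := by
    simpa using h.integrable_norm_rpow (by norm_num) (by norm_num)
  have hmeas : Measurable (fun q : ℝ × ℝ => ‖q.1 + q.2‖ ^ (4 : ℝ)) := by fun_prop
  have h2 : Integrable (fun q : ℝ × ℝ => ‖q.1 + q.2‖ ^ (4 : ℝ)) ((P.map X).prod (P.map Y)) := by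
    rw [← hm]
    exact (integrable_map_measure hmeas.aestronglyMeasurable
      (hX.prodMk hY).aemeasurable).2 h1
  have h3 := h2.prod_left_ae
  -- By Fubini, `X + y` is in `L⁴` for almost every value `y` of `Y`; a single such `y` suffices,
  -- since a constant can be subtracted.
  obtain ⟨y, hy⟩ := h3.exists
  have h4 : Integrable (fun ω => ‖X ω + y‖ ^ (4 : ℝ)) P :=
    (integrable_map_measure
      (hmeas.comp (measurable_id.prodMk measurable_const)).aestronglyMeasurable hX.aemeasurable).1 hy
  have h5 : MemLp (fun ω => X ω + y) 4 P := by
    rw [← integrable_norm_rpow_iff (by fun_prop) (by norm_num) (by norm_num)]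
    simpa using h4
  convert h5.sub (memLp_const y) using 1
  ext ω; simp

end Abstract

/-! ### Integrability, variance and fourth cumulant of a Lévy basis -/

section LevyBasis

variable {Ω : Type*} [MeasurableSpace Ω] {P : Measure Ω} [IsProbabilityMeasure P]
  {T : LevyTriplet} {L : Set (ℝ × ℝ) → Ω → ℝ}

namespace IsHomogeneousLevyBasis

lemma ae_empty (hL : IsHomogeneousLevyBasis P T L) : ∀ᵐ ω ∂P, L ∅ ω = 0 := by
  have h := hL.sigma_additive (fun _ => ∅) (fun _ => MeasurableSet.empty)
    (fun _ _ _ => disjoint_bot_left) (by simp)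
  filter_upwards [h] with ω hω
  simp only [Set.iUnion_empty, Finset.sum_const, Finset.card_range, nsmul_eq_mul] at hω
  -- The partial sums are `n * L ∅ ω`; since they converge, their constant difference `L ∅ ω` must
  -- vanish.
  have h1 := (hω.comp (tendsto_add_atTop_nat 1)).sub hω
  simp only [Function.comp_def, sub_self] at h1
  have h2 : (fun n : ℕ => ((n + 1 : ℕ) : ℝ) * L ∅ ω - n * L ∅ ω) = fun _ => L ∅ ω := by
    ext n; push_cast; ring
  rw [h2] at h1
  exact tendsto_nhds_unique tendsto_const_nhds h1

lemma ae_union (hL : IsHomogeneousLevyBasis P T L) {A B : Set (ℝ × ℝ)} (hA : MeasurableSet A)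
    (hB : MeasurableSet B) (hAB : Disjoint A B) (hA' : volume A < ∞) (hB' : volume B < ∞) :
    ∀ᵐ ω ∂P, L (A ∪ B) ω = L A ω + L B ω := by
  set C : ℕ → Set (ℝ × ℝ) := fun n => if n = 0 then A else if n = 1 then B else ∅ with hC
  have hU : ⋃ i, C i = A ∪ B := by
    ext p
    simp only [Set.mem_iUnion, Set.mem_union]
    constructor
    · rintro ⟨i, hi⟩
      simp only [hC] at hi
      split_ifs at hi with h1 h2
      · exact Or.inl hi
      · exact Or.inr hi
      · exact absurd hi (Set.notMem_empty _)
    · rintro (h | h)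
      · exact ⟨0, by simpa [hC] using h⟩
      · exact ⟨1, by simpa [hC] using h⟩
  have h := hL.sigma_additive C
    (fun i => by simp only [hC]; split_ifs <;> simp [hA, hB])
    (fun i j hij => by
      simp only [hC]
      split_ifs <;>
      first
      | exact hAB
      | exact hAB.symm
      | exact disjoint_bot_left
      | exact disjoint_bot_right
      | (exfalso; omega))
    (by rw [hU]; exact (measure_union_le A B).trans_lt (ENNReal.add_lt_top.2 ⟨hA', hB'⟩))
  filter_upwards [h, hL.ae_empty] with ω hω h0
  rw [hU] at hω
  refine tendsto_nhds_unique hω (tendsto_const_nhds.congr' ?_)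
  filter_upwards [eventually_ge_atTop 2] with n hn
  obtain ⟨m, rfl⟩ := Nat.exists_eq_add_of_le hn
  rw [Finset.sum_range_add]
  have h2 : ∀ x : ℕ, C (2 + x) = ∅ := fun x => by
    simp only [hC]
    rw [if_neg (by omega), if_neg (by omega)]
  simp only [h2, h0, Finset.sum_const_zero, Finset.sum_range_succ]
  simp [hC]

lemma ae_biUnion (hL : IsHomogeneousLevyBasis P T L) {ι : Type*} [DecidableEq ι] (s : Finset ι)
    {A : ι → Set (ℝ × ℝ)} (hA : ∀ i, MeasurableSet (A i)) (hA' : ∀ i, volume (A i) < ∞)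
    (hd : Pairwise fun i j => Disjoint (A i) (A j)) :
    ∀ᵐ ω ∂P, L (⋃ i ∈ s, A i) ω = ∑ i ∈ s, L (A i) ω := by
  induction s using Finset.induction_on with
  | empty => simpa using hL.ae_empty
  | insert j s hj ih =>
    have h := hL.ae_union (hA j) (s.measurableSet_biUnion fun i _ => hA i)
      (Set.disjoint_iUnion₂_right.2 fun i hi => hd (fun h => hj (h ▸ hi))) (hA' j)
      ((measure_biUnion_finset_le s A).trans_lt (ENNReal.sum_lt_top.2 fun i _ => hA' i))
    filter_upwards [h, ih] with ω h1 h2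
    rw [Finset.set_biUnion_insert, h1, h2, Finset.sum_insert hj]

lemma iIndepFun_family (hL : IsHomogeneousLevyBasis P T L) {ι : Type*} [Countable ι]
    {A : ι → Set (ℝ × ℝ)} (hA : ∀ i, MeasurableSet (A i)) (hA' : ∀ i, volume (A i) < ∞)
    (hd : Pairwise fun i j => Disjoint (A i) (A j)) : iIndepFun (fun i => L (A i)) P := by
  obtain ⟨g, hg⟩ := exists_injective_nat ι
  -- Padding with empty sets turns a countable family into a sequence without losing disjointness.
  set C : ℕ → Set (ℝ × ℝ) := Function.extend g A fun _ => ∅ with hC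
  have hCg : ∀ i, C (g i) = A i := fun i => hg.extend_apply A _ i
  have hCn : ∀ n, (∃ i, g i = n) ∨ C n = ∅ := fun n => by
    by_cases h : ∃ i, g i = n
    · exact Or.inl h
    · exact Or.inr (Function.extend_apply' A _ n h)
  have h := hL.independently_scattered C
    (fun n => by
      rcases hCn n with ⟨i, rfl⟩ | h
      · rw [hCg]; exact hA i
      · rw [h]; exact MeasurableSet.empty)
    (fun n => by
      rcases hCn n with ⟨i, rfl⟩ | h
      · rw [hCg]; exact hA' i
      · rw [h]; simp)
    (fun n m hnm => by
      rcases hCn n with ⟨i, rfl⟩ | h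
      · rcases hCn m with ⟨j, rfl⟩ | h
        · simp only [hCg]; exact hd fun hij => hnm (by rw [hij])
        · simp only [h]; exact disjoint_bot_right
      · simp only [h]; exact disjoint_bot_left)
  have h2 := h.precomp hg
  simpa only [hCg] using h2

lemma indepFun_of_disjoint (hL : IsHomogeneousLevyBasis P T L) {A B : Set (ℝ × ℝ)}
    (hA : MeasurableSet A) (hB : MeasurableSet B) (hAB : Disjoint A B) (hA' : volume A < ∞)
    (hB' : volume B < ∞) : IndepFun (L A) (L B) P := by
  have h := hL.iIndepFun_family (A := fun b : Bool => if b then A else B)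
    (fun b => by cases b <;> simpa) (fun b => by cases b <;> simpa)
    (fun b c hbc => by cases b <;> cases c <;> simp_all [hAB.symm])
  simpa using h.indepFun (i := true) (j := false) (by simp)

lemma identDistrib (hL : IsHomogeneousLevyBasis P T L) {A B : Set (ℝ × ℝ)}
    (hA : MeasurableSet A) (hB : MeasurableSet B) (hA' : volume A < ∞)
    (hAB : volume A = volume B) : IdentDistrib (L A) (L B) P P := by
  have mA := hL.measurable A hA hA'
  have mB := hL.measurable B hB (hAB ▸ hA')
  refine ⟨mA.aemeasurable, mB.aemeasurable, ?_⟩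
  have := Measure.isProbabilityMeasure_map (μ := P) mA.aemeasurable
  have := Measure.isProbabilityMeasure_map (μ := P) mB.aemeasurable
  refine Measure.ext_of_charFun (funext fun z => ?_)
  rw [hL.charFun_eq A hA hA', hL.charFun_eq B hB (hAB ▸ hA'), hAB]

end IsHomogeneousLevyBasis

lemma memLp_four_of_seedMoments {κ : Measure ℝ} [IsProbabilityMeasure κ] (h : SeedMoments κ) :
    MemLp id 4 κ := by
  obtain ⟨-, p, hp, hint⟩ := h
  rw [← integrable_norm_rpow_iff (by fun_prop) (by norm_num) (by norm_num)]
  refine ((integrable_const (1 : ℝ)).add hint).mono' ?_ (Eventually.of_forall fun x => ?_)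
  · exact (measurable_id.norm.pow_const _).aestronglyMeasurable
  · have h4 : (ENNReal.toReal 4) = 4 := by simp
    simp only [id, Real.norm_eq_abs, h4, Pi.add_apply]
    rw [abs_of_nonneg (by positivity)]
    rcases le_total |x| 1 with hx | hx
    · have := Real.rpow_le_one (abs_nonneg x) hx (by norm_num : (0 : ℝ) ≤ 4)
      have := Real.rpow_nonneg (abs_nonneg x) p
      linarith
    · have := Real.rpow_le_rpow_of_exponent_le hx (by linarith : (4 : ℝ) ≤ p)
      linarith

/-- The strip `(u, v] × (0, 1]`, of area `v - u`. -/
def strip (u v : ℝ) : Set (ℝ × ℝ) := Set.Ioc u v ×ˢ Set.Ioc 0 1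

lemma measurableSet_strip (u v : ℝ) : MeasurableSet (strip u v) :=
  measurableSet_Ioc.prod measurableSet_Ioc

lemma volume_strip (u v : ℝ) : volume (strip u v) = ENNReal.ofReal (v - u) := by
  rw [strip, Measure.volume_eq_prod, Measure.prod_prod]; simp

lemma strip_union {u v w : ℝ} (huv : u ≤ v) (hvw : v ≤ w) :
    strip u v ∪ strip v w = strip u w := by
  rw [strip, strip, strip, ← Set.union_prod, Set.Ioc_union_Ioc_eq_Ioc huv hvw]

lemma disjoint_strip (u v w : ℝ) : Disjoint (strip u v) (strip v w) :=
  Set.disjoint_prod.2 (Or.inl (Set.Ioc_disjoint_Ioc_of_le le_rfl))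

variable {κ : Measure ℝ}

namespace IsHomogeneousLevyBasis

lemma map_eq_seed (hL : IsHomogeneousLevyBasis P T L) (hκ : IsLevySeedLaw T κ)
    {A : Set (ℝ × ℝ)} (hA : MeasurableSet A) (hA' : volume A = 1) : P.map (L A) = κ := by
  have := hκ.1
  have mA := hL.measurable A hA (by simp [hA'])
  have := Measure.isProbabilityMeasure_map (μ := P) mA.aemeasurable
  refine Measure.ext_of_charFun (funext fun z => ?_)
  rw [hL.charFun_eq A hA (by simp [hA']), hκ.2, hA']
  simp

lemma ae_strip (hL : IsHomogeneousLevyBasis P T L) {u v w : ℝ} (huv : u ≤ v) (hvw : v ≤ w) :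
    ∀ᵐ ω ∂P, L (strip u w) ω = L (strip u v) ω + L (strip v w) ω := by
  rw [← strip_union huv hvw]
  exact hL.ae_union (measurableSet_strip _ _) (measurableSet_strip _ _) (disjoint_strip _ _ _)
    (by simp [volume_strip]) (by simp [volume_strip])

/-- The unit strip carries the seed law and splits into two independent strips, so its fourth moment
passes to the first of them. -/
lemma memLp_strip_le_one (hL : IsHomogeneousLevyBasis P T L) (hκ : IsLevySeedLaw T κ)
    (hmom : SeedMoments κ) {s : ℝ} (hs : 0 ≤ s) (hs1 : s ≤ 1) : MemLp (L (strip 0 s)) 4 P := by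
  have := hκ.1
  have hv : ∀ u v, volume (strip u v) < ∞ := fun u v => by simp [volume_strip]
  have hm : ∀ u v, Measurable (L (strip u v)) := fun u v =>
    hL.measurable _ (measurableSet_strip _ _) (hv u v)
  have h1 : MemLp (L (strip 0 1)) 4 P := by
    have h := memLp_four_of_seedMoments hmom
    rw [← hL.map_eq_seed hκ (measurableSet_strip 0 1) (by simp [volume_strip])] at h
    exact (memLp_map_measure_iff aestronglyMeasurable_id (hm 0 1).aemeasurable).1 h
  refine memLp_of_indepFun_add (hm 0 s) (hm s 1) (hL.indepFun_of_disjoint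
    (measurableSet_strip _ _) (measurableSet_strip _ _) (disjoint_strip _ _ _) (hv _ _) (hv _ _))
    (h1.ae_eq (hL.ae_strip hs hs1))

/-- Unit strips are added one at a time to reach any area; equality in law for equal areas then
moves the result from strips to arbitrary sets. -/
lemma memLp_four (hL : IsHomogeneousLevyBasis P T L) (hκ : IsLevySeedLaw T κ)
    (hmom : SeedMoments κ) {A : Set (ℝ × ℝ)} (hA : MeasurableSet A) (hA' : volume A < ∞) :
    MemLp (L A) 4 P := by
  have hv : ∀ u v, volume (strip u v) < ∞ := fun u v => by simp [volume_strip]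
  have key : ∀ n : ℕ, ∀ s : ℝ, 0 ≤ s → s ≤ n + 1 → MemLp (L (strip 0 s)) 4 P := by
    intro n
    induction n with
    | zero => intro s hs hs1; exact hL.memLp_strip_le_one hκ hmom hs (by simpa using hs1)
    | succ n ih =>
      intro s hs hs1
      rcases le_total s 1 with h | h
      · exact hL.memLp_strip_le_one hκ hmom hs h
      · have h2 : MemLp (L (strip 1 s)) 4 P :=
          (hL.identDistrib (measurableSet_strip _ _) (measurableSet_strip _ _) (hv _ _)
            (by simp [volume_strip])).memLp_iff.1
            (ih (s - 1) (by linarith) (by push_cast at hs1; linarith))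
        exact ((hL.memLp_strip_le_one hκ hmom zero_le_one le_rfl).add h2).ae_eq
          ((hL.ae_strip zero_le_one h).mono fun ω h => h.symm)
  obtain ⟨n, hn⟩ := exists_nat_ge (volume A).toReal
  refine (hL.identDistrib (measurableSet_strip _ _) hA (hv _ _) ?_).memLp_iff.1
    (key n (volume A).toReal ENNReal.toReal_nonneg (by linarith))
  rw [volume_strip, sub_zero, ENNReal.ofReal_toReal hA'.ne]

end IsHomogeneousLevyBasis

/-- The centred value `L(A) - 𝔼 L(A)`. -/
def centredBasis (P : Measure Ω) (L : Set (ℝ × ℝ) → Ω → ℝ) (A : Set (ℝ × ℝ)) (ω : Ω) : ℝ :=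
  L A ω - ∫ ω', L A ω' ∂P

namespace IsHomogeneousLevyBasis

lemma measurable_centred (hL : IsHomogeneousLevyBasis P T L) {A : Set (ℝ × ℝ)}
    (hA : MeasurableSet A) (hA' : volume A < ∞) : Measurable (centredBasis P L A) :=
  (hL.measurable A hA hA').sub_const _

lemma memLp_centred (hL : IsHomogeneousLevyBasis P T L) (hκ : IsLevySeedLaw T κ)
    (hmom : SeedMoments κ) {A : Set (ℝ × ℝ)} (hA : MeasurableSet A) (hA' : volume A < ∞) :
    MemLp (centredBasis P L A) 4 P :=
  (hL.memLp_four hκ hmom hA hA').sub (memLp_const _)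

lemma integral_centred (hL : IsHomogeneousLevyBasis P T L) (hκ : IsLevySeedLaw T κ)
    (hmom : SeedMoments κ) {A : Set (ℝ × ℝ)} (hA : MeasurableSet A) (hA' : volume A < ∞) :
    ∫ ω, centredBasis P L A ω ∂P = 0 := by
  simp only [centredBasis]
  rw [integral_sub (integrable_of_memLp_four (hL.memLp_four hκ hmom hA hA')) (integrable_const _)]
  simp

lemma integral_centred_pow_congr (hL : IsHomogeneousLevyBasis P T L) {A B : Set (ℝ × ℝ)}
    (hA : MeasurableSet A) (hB : MeasurableSet B) (hA' : volume A < ∞)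
    (hAB : volume A = volume B) (n : ℕ) :
    ∫ ω, centredBasis P L A ω ^ n ∂P = ∫ ω, centredBasis P L B ω ^ n ∂P := by
  have h := hL.identDistrib hA hB hA' hAB
  have he : ∫ ω, L A ω ∂P = ∫ ω, L B ω ∂P := h.integral_eq
  simp only [centredBasis, he]
  exact (h.comp (u := fun x => (x - ∫ ω, L B ω ∂P) ^ n) (by fun_prop)).integral_eq

/-- The factor `1 *` gives the sum the shape `A + a * ξ` of `integral_mul_add_indep` and its
fourth-order analogue. -/
lemma ae_centred_strip (hL : IsHomogeneousLevyBasis P T L) (hκ : IsLevySeedLaw T κ)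
    (hmom : SeedMoments κ) {u v w : ℝ} (huv : u ≤ v) (hvw : v ≤ w) :
    ∀ᵐ ω ∂P, centredBasis P L (strip u w) ω
      = centredBasis P L (strip u v) ω + 1 * centredBasis P L (strip v w) ω := by
  have h := hL.ae_strip huv hvw
  have hi : ∀ u v, Integrable (L (strip u v)) P := fun u v =>
    integrable_of_memLp_four (hL.memLp_four hκ hmom (measurableSet_strip _ _)
      (by simp [volume_strip]))
  have he : ∫ ω, L (strip u w) ω ∂P = ∫ ω, L (strip u v) ω ∂P + ∫ ω, L (strip v w) ω ∂P := by
    rw [integral_congr_ae h, integral_add (hi _ _) (hi _ _)]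
  filter_upwards [h] with ω hω
  simp only [centredBasis, he, hω]; ring

/-- Additivity of the second and fourth cumulants along strips. -/
lemma integral_centred_strip_add (hL : IsHomogeneousLevyBasis P T L) (hκ : IsLevySeedLaw T κ)
    (hmom : SeedMoments κ) {s u : ℝ} (hs : 0 ≤ s) (hu : 0 ≤ u) :
    ∫ ω, centredBasis P L (strip 0 (s + u)) ω ^ 2 ∂P
        = ∫ ω, centredBasis P L (strip 0 s) ω ^ 2 ∂P + ∫ ω, centredBasis P L (strip 0 u) ω ^ 2 ∂P
    ∧ ∫ ω, centredBasis P L (strip 0 (s + u)) ω ^ 4 ∂P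
        = ∫ ω, centredBasis P L (strip 0 s) ω ^ 4 ∂P + ∫ ω, centredBasis P L (strip 0 u) ω ^ 4 ∂P
          + 6 * (∫ ω, centredBasis P L (strip 0 s) ω ^ 2 ∂P)
            * ∫ ω, centredBasis P L (strip 0 u) ω ^ 2 ∂P := by
  have hv : ∀ u v, volume (strip u v) < ∞ := fun u v => by simp [volume_strip]
  have hc := hL.ae_centred_strip hκ hmom hs (le_add_of_nonneg_right hu : s ≤ s + u)
  have hshift : ∀ n : ℕ, ∫ ω, centredBasis P L (strip 0 u) ω ^ n ∂P
      = ∫ ω, centredBasis P L (strip s (s + u)) ω ^ n ∂P := fun n =>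
    hL.integral_centred_pow_congr (measurableSet_strip _ _) (measurableSet_strip _ _) (hv _ _)
      (by simp [volume_strip]) n
  have m1 := hL.memLp_centred hκ hmom (measurableSet_strip 0 s) (hv _ _)
  have m2 := hL.memLp_centred hκ hmom (measurableSet_strip s (s + u)) (hv _ _)
  have z1 := hL.integral_centred hκ hmom (measurableSet_strip 0 s) (hv _ _)
  have z2 := hL.integral_centred hκ hmom (measurableSet_strip s (s + u)) (hv _ _)
  have ind : IndepFun (centredBasis P L (strip 0 s)) (centredBasis P L (strip s (s + u))) P :=
    (hL.indepFun_of_disjoint (measurableSet_strip 0 s) (measurableSet_strip s (s + u))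
      (disjoint_strip _ _ _) (hv _ _) (hv _ _)).comp
      (φ := fun x => x - ∫ ω, L (strip 0 s) ω ∂P)
      (ψ := fun x => x - ∫ ω, L (strip s (s + u)) ω ∂P) (by fun_prop) (by fun_prop)
  have q2 := integral_mul_add_indep m1 m1 m2
    (ind.comp (φ := fun x => (x, x)) (ψ := id) (by fun_prop) measurable_id) z2 1 1
  have q4 := integral_mul_four_add_indep m1 m1 m1 m1 m2
    (ind.comp (φ := fun x => (x, x, x, x)) (ψ := id) (by fun_prop) measurable_id) z2 z1 z1 z1 z1
    1 1 1 1
  rw [hshift, hshift]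
  constructor
  · rw [integral_congr_ae (hc.mono fun ω hω => congrArg (fun x => x ^ 2) hω)]
    simp only [pow_two] at q2 ⊢
    rw [q2]; ring
  · rw [integral_congr_ae (hc.mono fun ω hω => congrArg (fun x => x ^ 4) hω)]
    have e : ∀ x : ℝ, x ^ 4 = x * x * x * x := fun x => by ring
    have e' : ∀ x : ℝ, x ^ 2 = x * x := fun x => by ring
    simp only [e, e'] at q4 ⊢
    rw [q4]; ring

/-- The variance of `L(A)` is the area of `A`. -/
lemma integral_centred_sq (hL : IsHomogeneousLevyBasis P T L) (hκ : IsLevySeedLaw T κ)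
    (hmom : SeedMoments κ) {A : Set (ℝ × ℝ)} (hA : MeasurableSet A) (hA' : volume A < ∞) :
    ∫ ω, centredBasis P L A ω ^ 2 ∂P = (volume A).toReal := by
  set f : ℝ → ℝ := fun s => ∫ ω, centredBasis P L (strip 0 s) ω ^ 2 ∂P with hf
  have f0 : ∀ s, 0 ≤ f s := fun s => integral_nonneg fun ω => sq_nonneg _
  have fadd : ∀ s u, 0 ≤ s → 0 ≤ u → f (s + u) = f s + f u := fun s u hs hu =>
    (hL.integral_centred_strip_add hκ hmom hs hu).1
  -- The bound needed for linearity comes from monotonicity: `f 1 = f s + f (1 - s)` with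
  -- nonnegative terms.
  have flin := fun s => eq_mul_of_additive_of_bounded (B := f 1) (s := s) fadd fun s hs hs1 => by
    have := fadd s (1 - s) hs (by linarith)
    rw [abs_of_nonneg (f0 s)]
    have := f0 (1 - s)
    simp only [add_sub_cancel] at *
    linarith
  have f1 : f 1 = 1 := by
    have hm := hL.measurable (strip 0 1) (measurableSet_strip _ _) (by simp [volume_strip])
    have h := hmom.1
    rw [← hL.map_eq_seed hκ (measurableSet_strip 0 1) (by simp [volume_strip]),
      variance_map (by fun_prop) hm.aemeasurable, Function.id_comp,
      variance_eq_integral hm.aemeasurable] at h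
    exact h
  rw [hL.integral_centred_pow_congr hA (measurableSet_strip 0 (volume A).toReal) hA'
    (by rw [volume_strip, sub_zero, ENNReal.ofReal_toReal hA'.ne]) 2]
  exact (flin _ ENNReal.toReal_nonneg).trans (by rw [f1, mul_one])

/-- The fourth cumulant of `L(A)` is proportional to the area of `A`. -/
lemma exists_fourth_cumulant (hL : IsHomogeneousLevyBasis P T L) (hκ : IsLevySeedLaw T κ)
    (hmom : SeedMoments κ) : ∃ K : ℝ, ∀ A : Set (ℝ × ℝ), MeasurableSet A → volume A < ∞ →
      ∫ ω, centredBasis P L A ω ^ 4 ∂P - 3 * (∫ ω, centredBasis P L A ω ^ 2 ∂P) ^ 2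
        = (volume A).toReal * K := by
  set f : ℝ → ℝ := fun s => ∫ ω, centredBasis P L (strip 0 s) ω ^ 2 ∂P with hf
  set g : ℝ → ℝ := fun s => ∫ ω, centredBasis P L (strip 0 s) ω ^ 4 ∂P with hg
  have g0 : ∀ s, 0 ≤ g s := fun s => integral_nonneg fun ω => by positivity
  have fs : ∀ s, 0 ≤ s → f s = s := fun s hs => by
    have := hL.integral_centred_sq hκ hmom (measurableSet_strip 0 s) (by simp [volume_strip])
    rw [volume_strip, sub_zero, ENNReal.toReal_ofReal hs] at this
    exact this
  have gadd : ∀ s u, 0 ≤ s → 0 ≤ u → g (s + u) = g s + g u + 6 * s * u := fun s u hs hu => by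
    have h : g (s + u) = g s + g u + 6 * f s * f u :=
      (hL.integral_centred_strip_add hκ hmom hs hu).2
    rw [h, fs s hs, fs u hu]
  -- Subtracting `3 * s ^ 2` absorbs the cross term `6 * s * u` and leaves an additive function. The
  -- bound `g 1 + 3` follows from `0 ≤ g s ≤ g 1` on `[0, 1]`.
  have glin := fun s => eq_mul_of_additive_of_bounded (f := fun s => g s - 3 * s ^ 2) (s := s)
    (B := g 1 + 3) (fun s u hs hu => by rw [gadd s u hs hu]; ring) fun s hs hs1 => by
      have h1 := gadd s (1 - s) hs (by linarith)
      have h2 := g0 (1 - s)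
      have h3 := g0 s
      have h4 : 0 ≤ s * (1 - s) := mul_nonneg hs (by linarith)
      rw [add_sub_cancel] at h1
      rw [abs_le]
      constructor <;> nlinarith
  refine ⟨g 1 - 3 * 1 ^ 2, fun A hA hA' => ?_⟩
  have hvol : volume A = volume (strip 0 (volume A).toReal) := by
    rw [volume_strip, sub_zero, ENNReal.ofReal_toReal hA'.ne]
  rw [hL.integral_centred_pow_congr hA (measurableSet_strip 0 (volume A).toReal) hA' hvol 4,
    hL.integral_centred_sq hκ hmom hA hA']
  exact glin _ ENNReal.toReal_nonneg

end IsHomogeneousLevyBasis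
end LevyBasis

/-! ### Areas of trawl sets and of the cells cut out by the grid -/

section TrawlGeometry

/-- The area of a region between two graphs over `(u, w]` whose height lies in `[m, M]`. -/
lemma volume_real_between_bounds {E : Set (ℝ × ℝ)} (hE : MeasurableSet E) {u w m M : ℝ}
    {g h : ℝ → ℝ} (huw : u ≤ w) (hm0 : 0 ≤ m)
    (hEq : ∀ p : ℝ × ℝ, p ∈ E ↔ (u < p.1 ∧ p.1 ≤ w) ∧ g p.1 < p.2 ∧ p.2 ≤ h p.1)
    (hm : ∀ r, u < r → r ≤ w → m ≤ h r - g r) (hM : ∀ r, u < r → r ≤ w → h r - g r ≤ M) :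
    m * (w - u) ≤ volume.real E ∧ volume.real E ≤ max M 0 * (w - u) := by
  have hsec : ∀ r, volume (Prod.mk r ⁻¹' E)
      = (Set.Ioc u w).indicator (fun r => ENNReal.ofReal (h r - g r)) r := by
    intro r
    by_cases hr : r ∈ Set.Ioc u w
    · rw [Set.indicator_of_mem hr, ← Real.volume_Ioc]
      congr 1
      ext y
      simp only [Set.mem_preimage, hEq, Set.mem_Ioc] at hr ⊢
      tauto
    · rw [Set.indicator_of_notMem hr]
      convert measure_empty (μ := (volume : Measure ℝ))
      ext y
      simp only [Set.mem_preimage, hEq, Set.mem_Ioc, Set.mem_empty_iff_false] at hr ⊢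
      tauto
  have hvol : volume E = ∫⁻ r in Set.Ioc u w, ENNReal.ofReal (h r - g r) := by
    rw [Measure.volume_eq_prod, Measure.prod_apply hE, ← lintegral_indicator measurableSet_Ioc]
    exact lintegral_congr hsec
  have hc : ∀ c : ℝ, ∫⁻ _ in Set.Ioc u w, ENNReal.ofReal c = ENNReal.ofReal (c * (w - u)) ∨ c < 0 := by
    intro c
    rcases lt_or_ge c 0 with h | h
    · exact Or.inr h
    · left
      rw [setLIntegral_const, Real.volume_Ioc, ENNReal.ofReal_mul h]
  have hup : volume E ≤ ENNReal.ofReal (max M 0 * (w - u)) := by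
    rw [hvol, ← (hc (max M 0)).resolve_right (not_lt.2 (le_max_right _ _))]
    exact setLIntegral_mono' measurableSet_Ioc fun r hr =>
      ENNReal.ofReal_le_ofReal ((hM r hr.1 hr.2).trans (le_max_left _ _))
  have hlo : ENNReal.ofReal (m * (w - u)) ≤ volume E := by
    rw [hvol, ← (hc m).resolve_right (not_lt.2 hm0)]
    exact setLIntegral_mono' measurableSet_Ioc fun r hr =>
      ENNReal.ofReal_le_ofReal (hm r hr.1 hr.2)
  constructor
  · exact (ENNReal.ofReal_le_iff_le_toReal (hup.trans_lt ENNReal.ofReal_lt_top).ne).1 hlo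
  · exact ENNReal.toReal_le_of_le_ofReal
      (mul_nonneg (le_max_right _ _) (sub_nonneg.2 huw)) hup

variable {a : ℝ → ℝ}

lemma mem_trawlSetAt {t : ℝ} {p : ℝ × ℝ} :
    p ∈ trawlSetAt a t ↔ p.1 ≤ t ∧ 0 ≤ p.2 ∧ p.2 ≤ a (t - p.1) := by
  simp [trawlSetAt, trawlSet]

/-- Since `a` decreases, a point that has left the moving trawl set never returns. The grid times at
which it belongs therefore form an interval, which is why cells need only two indices. -/
lemma mem_trawlSetAt_of_le (ha : IsTrawlFunction a) {s t : ℝ} {p : ℝ × ℝ} (hst : s ≤ t)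
    (hp : p ∈ trawlSetAt a t) (hs : p.1 ≤ s) : p ∈ trawlSetAt a s := by
  rw [mem_trawlSetAt] at hp ⊢
  exact ⟨hs, hp.2.1, hp.2.2.trans (ha.antitoneOn (sub_nonneg.2 hs) (sub_nonneg.2 hp.1)
    (by linarith))⟩

lemma measurableSet_trawlSetAt (ha : IsTrawlFunction a) (t : ℝ) :
    MeasurableSet (trawlSetAt a t) := by
  have hc : Continuous fun x => a (max x 0) := by
    exact ha.continuousOn.comp_continuous (by fun_prop) fun x => Set.mem_Ici.2 (le_max_right _ _)
  have : trawlSetAt a t = {p | p.1 ≤ t} ∩ {p | 0 ≤ p.2} ∩ {p | p.2 ≤ a (max (t - p.1) 0)} := by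
    ext p
    rw [mem_trawlSetAt]
    simp only [Set.mem_inter_iff, Set.mem_ofPred_eq]
    constructor
    · rintro ⟨h1, h2, h3⟩
      exact ⟨⟨h1, h2⟩, by rwa [max_eq_left (sub_nonneg.2 h1)]⟩
    · rintro ⟨⟨h1, h2⟩, h3⟩
      exact ⟨h1, h2, by rwa [max_eq_left (sub_nonneg.2 h1)] at h3⟩
  rw [this]
  refine ((isClosed_le (by fun_prop) (by fun_prop)).inter
    (isClosed_le (by fun_prop) (by fun_prop))).inter
    (isClosed_le (by fun_prop) ?_) |>.measurableSet
  exact hc.comp (continuous_const.sub continuous_fst)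

lemma volume_trawlSetAt_lt_top (ha : IsTrawlFunction a) (t : ℝ) :
    volume (trawlSetAt a t) < ∞ := by
  rw [Measure.volume_eq_prod, Measure.prod_apply (measurableSet_trawlSetAt ha t)]
  have hi : Integrable ((Set.Ici (0 : ℝ)).indicator a) :=
    (integrable_indicator_iff measurableSet_Ici).2 ha.integrableOn
  refine lt_of_le_of_lt (lintegral_mono fun r => ?_) (hi.comp_sub_left t).lintegral_lt_top
  by_cases hr : r ≤ t
  · rw [Set.indicator_of_mem (by simpa using hr)]
    refine (measure_mono (t := Set.Icc 0 (a (t - r))) fun y hy => ?_).trans (by simp)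
    exact (mem_trawlSetAt.1 hy).2
  · have : Prod.mk r ⁻¹' trawlSetAt a t = ∅ := by
      ext y
      simp only [Set.mem_preimage, mem_trawlSetAt, Set.mem_empty_iff_false]
      tauto
    simp [this]

lemma volume_trawlSetAt_eq (s t : ℝ) : volume (trawlSetAt a s) = volume (trawlSetAt a t) := by
  have h : ∀ t, volume (trawlSetAt a t) = volume (trawlSet a) := fun t =>
    (measurePreserving_sub_right (volume : Measure (ℝ × ℝ)) (t, 0)).measure_preimage_equiv
      (f := MeasurableEquiv.subRight ((t, 0) : ℝ × ℝ)) (trawlSet a)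
  rw [h, h]

lemma volume_real_trawlSetAt_diff_le (ha : IsTrawlFunction a) {s t : ℝ} (hst : s ≤ t) :
    volume.real (trawlSetAt a t \ trawlSetAt a s) ≤ a 0 * (t - s) := by
  have hsub : trawlSetAt a t \ trawlSetAt a s ⊆ Set.Ioc s t ×ˢ Set.Icc 0 (a 0) := by
    rintro p ⟨h1, h2⟩
    have h3 : s < p.1 := by
      by_contra h
      exact h2 (mem_trawlSetAt_of_le ha hst h1 (not_lt.1 h))
    rw [mem_trawlSetAt] at h1
    exact ⟨⟨h3, h1.1⟩, h1.2.1, h1.2.2.trans (ha.antitoneOn (Set.mem_Ici.2 le_rfl)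
      (sub_nonneg.2 h1.1) (sub_nonneg.2 h1.1))⟩
  have hv : volume (Set.Ioc s t ×ˢ Set.Icc 0 (a 0)) = ENNReal.ofReal (a 0 * (t - s)) := by
    rw [Measure.volume_eq_prod, Measure.prod_prod, Real.volume_Ioc, Real.volume_Icc, sub_zero,
      mul_comm, ENNReal.ofReal_mul (ha.nonneg 0 le_rfl)]
  exact ENNReal.toReal_le_of_le_ofReal (mul_nonneg (ha.nonneg 0 le_rfl) (sub_nonneg.2 hst))
    ((measure_mono hsub).trans hv.le)

/-- Both sets have the same finite area and share their intersection, so the two differences have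
equal area. -/
lemma volume_real_trawlSetAt_diff_le' (ha : IsTrawlFunction a) {s t : ℝ} (hst : s ≤ t) :
    volume.real (trawlSetAt a s \ trawlSetAt a t) ≤ a 0 * (t - s) := by
  have h1 := volume_real_trawlSetAt_diff_le ha hst
  have e1 := measureReal_sdiff_add_inter (μ := volume) (s := trawlSetAt a t)
    (measurableSet_trawlSetAt ha s) (volume_trawlSetAt_lt_top ha t).ne
  have e2 := measureReal_sdiff_add_inter (μ := volume) (s := trawlSetAt a s)
    (measurableSet_trawlSetAt ha t) (volume_trawlSetAt_lt_top ha s).ne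
  have e3 : volume.real (trawlSetAt a s) = volume.real (trawlSetAt a t) :=
    congrArg ENNReal.toReal (volume_trawlSetAt_eq s t)
  rw [Set.inter_comm] at e2
  linarith

/-- The points which lie in `A_{kΔ}`, `k < N`, exactly for `q.1 ≤ k ≤ q.2`. -/
def trawlCell (a : ℝ → ℝ) (Δ : ℝ) (N : ℕ) (q : ℕ × ℕ) : Set (ℝ × ℝ) :=
  {p | q.1 ≤ q.2 ∧ q.2 < N ∧ ∀ k < N, p ∈ trawlSetAt a (k * Δ) ↔ q.1 ≤ k ∧ k ≤ q.2}

/-- The indices of the cells which can be nonempty. -/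
def cellIndex (N : ℕ) : Finset (ℕ × ℕ) :=
  (Finset.range N ×ˢ Finset.range N).filter fun q => q.1 ≤ q.2

lemma mem_cellIndex {N : ℕ} {q : ℕ × ℕ} : q ∈ cellIndex N ↔ q.1 ≤ q.2 ∧ q.2 < N := by
  simp only [cellIndex, Finset.mem_filter, Finset.mem_product, Finset.mem_range]
  omega

/-- The coefficient of the increment `δ_k X` at the cell `q`: points of the cell enter the trawl
set between `q.1 - 1` and `q.1` and leave it between `q.2` and `q.2 + 1`. -/
def incrementCoeff (k : ℕ) (q : ℕ × ℕ) : ℝ :=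
  (if q.1 = k + 1 then 1 else 0) - (if q.2 = k then 1 else 0)

variable {Δ : ℝ} {N : ℕ}

lemma measurableSet_trawlCell (ha : IsTrawlFunction a) (q : ℕ × ℕ) :
    MeasurableSet (trawlCell a Δ N q) := by
  have : trawlCell a Δ N q = {_p | q.1 ≤ q.2} ∩ ({_p | q.2 < N} ∩ ⋂ k, ⋂ (_ : k < N),
      {p | p ∈ trawlSetAt a (k * Δ) ↔ q.1 ≤ k ∧ k ≤ q.2}) := by
    ext p; simp [trawlCell]
  rw [this]
  refine (MeasurableSet.const _).inter ((MeasurableSet.const _).inter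
    (MeasurableSet.iInter fun k => MeasurableSet.iInter fun _ => ?_))
  by_cases h : q.1 ≤ k ∧ k ≤ q.2
  · convert measurableSet_trawlSetAt ha (k * Δ) using 1
    ext p; simp [h]
  · convert (measurableSet_trawlSetAt ha (k * Δ)).compl using 1
    ext p; simp only [Set.mem_ofPred_eq, Set.mem_compl_iff, h, iff_false]

lemma trawlCell_subset (q : ℕ × ℕ) : trawlCell a Δ N q ⊆ trawlSetAt a (q.1 * Δ) :=
  fun _ hp => (hp.2.2 q.1 (hp.1.trans_lt hp.2.1)).2 ⟨le_rfl, hp.1⟩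

lemma volume_trawlCell_lt_top (ha : IsTrawlFunction a) (q : ℕ × ℕ) :
    volume (trawlCell a Δ N q) < ∞ :=
  (measure_mono (trawlCell_subset q)).trans_lt (volume_trawlSetAt_lt_top ha _)

lemma disjoint_trawlCell :
    Pairwise fun q r => Disjoint (trawlCell a Δ N q) (trawlCell a Δ N r) := by
  intro q r hqr
  rw [Set.disjoint_left]
  rintro p ⟨h1, h2, h3⟩ ⟨h4, h5, h6⟩
  apply hqr
  have e : ∀ k < N, (q.1 ≤ k ∧ k ≤ q.2) ↔ (r.1 ≤ k ∧ k ≤ r.2) := fun k hk =>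
    (h3 k hk).symm.trans (h6 k hk)
  have e1 := e q.1 (by omega)
  have e2 := e q.2 (by omega)
  have e3 := e r.1 (by omega)
  have e4 := e r.2 (by omega)
  ext <;> omega

lemma trawlSetAt_eq_biUnion (ha : IsTrawlFunction a) (hΔ : 0 ≤ Δ) {k : ℕ} (hk : k < N) :
    trawlSetAt a (k * Δ) = ⋃ q ∈ (cellIndex N).filter (fun q => q.1 ≤ k ∧ k ≤ q.2),
      trawlCell a Δ N q := by
  classical
  ext p
  simp only [Set.mem_iUnion, Finset.mem_filter, mem_cellIndex]
  constructor
  · intro hp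
    -- The cell containing `p` is read off from the first and last grid times at which `p` belongs
    -- to the trawl set.
    set F : Finset ℕ := (Finset.range N).filter fun l : ℕ => p ∈ trawlSetAt a (l * Δ) with hF
    have hkF : k ∈ F := by simp [hF, hk, hp]
    have hne : F.Nonempty := ⟨k, hkF⟩
    have hmin := F.min'_mem hne
    have hmax := F.max'_mem hne
    have hle := F.min'_le k hkF
    have hge := F.le_max' k hkF
    simp only [hF, Finset.mem_filter, Finset.mem_range] at hmin hmax
    refine ⟨(F.min' hne, F.max' hne), ⟨⟨hle.trans hge, hmax.1⟩, hle, hge⟩, hle.trans hge, hmax.1,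
      fun l hl => ⟨fun h => ?_, fun h => ?_⟩⟩
    · have hlF : l ∈ F := by simp [hF, hl, h]
      exact ⟨F.min'_le l hlF, F.le_max' l hlF⟩
    · refine mem_trawlSetAt_of_le ha (mul_le_mul_of_nonneg_right (Nat.cast_le.2 h.2) hΔ) hmax.2 ?_
      exact (mem_trawlSetAt.1 hmin.2).1.trans
        (mul_le_mul_of_nonneg_right (Nat.cast_le.2 h.1) hΔ)
  · rintro ⟨q, ⟨_, hq⟩, hp⟩
    exact (hp.2.2 k hk).2 hq

lemma abs_incrementCoeff_le (k : ℕ) (q : ℕ × ℕ) :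
    |incrementCoeff k q| ≤ (if q.1 = k + 1 then 1 else 0) + (if q.2 = k then 1 else 0) := by
  unfold incrementCoeff
  split_ifs <;> norm_num

lemma abs_incrementCoeff_le_one (k : ℕ) (q : ℕ × ℕ) : |incrementCoeff k q| ≤ 1 := by
  unfold incrementCoeff
  split_ifs <;> norm_num

lemma sum_abs_incrementCoeff_le (s : Finset ℕ) (q : ℕ × ℕ) :
    ∑ k ∈ s, |incrementCoeff k q| ≤ 2 := by
  refine (Finset.sum_le_sum fun k _ => abs_incrementCoeff_le k q).trans ?_
  rw [Finset.sum_add_distrib]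
  have h1 : ∑ k ∈ s, (if q.1 = k + 1 then (1 : ℝ) else 0) ≤ 1 := by
    -- Only an inequality holds: for `q.1 = 0` the truncated `q.1 - 1` is `0`, yet no increment sees
    -- the entry of such a cell.
    have : ∀ k, (if q.1 = k + 1 then (1 : ℝ) else 0) ≤ if k = q.1 - 1 then 1 else 0 := fun k => by
      split_ifs <;> first | (exfalso; omega) | norm_num
    refine (Finset.sum_le_sum fun k _ => this k).trans ?_
    rw [Finset.sum_ite_eq']
    split_ifs <;> norm_num
  have h2 : ∑ k ∈ s, (if q.2 = k then (1 : ℝ) else 0) ≤ 1 := by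
    rw [Finset.sum_ite_eq]
    split_ifs <;> norm_num
  linarith

/-- Two different pairs of increments at the same lag have no common cell. -/
lemma incrementCoeff_mul_four_eq_zero {j k m : ℕ} (hj : 1 ≤ j) (hk : j ≤ k) (hm : j ≤ m)
    (hkm : k ≠ m) (q : ℕ × ℕ) :
    incrementCoeff k q * incrementCoeff (k - j) q * incrementCoeff m q * incrementCoeff (m - j) q
      = 0 := by
  have h : ∀ l, incrementCoeff l q ≠ 0 → q.1 = l + 1 ∨ q.2 = l := fun l hl => by
    by_contra hc
    push Not at hc
    exact hl (by simp [incrementCoeff, hc.1, hc.2])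
  by_contra hne
  simp only [mul_ne_zero_iff] at hne
  obtain ⟨⟨⟨h1, h2⟩, h3⟩, h4⟩ := hne
  have := h _ h1
  have := h _ h2
  have := h _ h3
  have := h _ h4
  omega

/-- The increments at `k` and `k - j` share exactly one cell, with coefficients of opposite
sign. -/
lemma incrementCoeff_mul_lag {j k : ℕ} (hj : 1 ≤ j) (hk : j ≤ k) {q : ℕ × ℕ} (hq : q.1 ≤ q.2) :
    incrementCoeff k q * incrementCoeff (k - j) q = if q = (k - j + 1, k) then -1 else 0 := by
  obtain ⟨i, i'⟩ := q
  simp only [incrementCoeff, Prod.mk.injEq] at hq ⊢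
  split_ifs <;> first | (exfalso; omega) | norm_num

/-- Cells with a nonzero coefficient lie in the region gained or in the region lost during one step,
each of area at most `a 0 * Δ`. -/
lemma sum_abs_incrementCoeff_mul_volume_le (ha : IsTrawlFunction a) (hΔ : 0 ≤ Δ) {k : ℕ}
    (hk : k + 1 < N) :
    ∑ q ∈ cellIndex N, |incrementCoeff k q| * volume.real (trawlCell a Δ N q)
      ≤ 2 * a 0 * Δ := by
  have hle : (k : ℝ) * Δ ≤ ((k + 1 : ℕ) : ℝ) * Δ := by push_cast; linarith
  have hd : ((k + 1 : ℕ) : ℝ) * Δ - k * Δ = Δ := by push_cast; ring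
  have key : ∀ (R : ℕ × ℕ → Prop) [DecidablePred R] (B : Set (ℝ × ℝ)), volume B < ∞ →
      (∀ q, R q → trawlCell a Δ N q ⊆ B) →
      ∑ q ∈ cellIndex N, (if R q then 1 else 0) * volume.real (trawlCell a Δ N q)
        ≤ volume.real B := by
    intro R _ B hB hsub
    simp only [ite_mul, one_mul, zero_mul]
    rw [← Finset.sum_filter, ← measureReal_biUnion_finset
      (fun q _ r _ h => disjoint_trawlCell h) (fun q _ => measurableSet_trawlCell ha q)
      (fun q _ => (volume_trawlCell_lt_top ha q).ne)]
    refine measureReal_mono (Set.iUnion₂_subset fun q hq => hsub q (Finset.mem_filter.1 hq).2)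
      hB.ne
  have fin : ∀ s t, volume (trawlSetAt a s \ trawlSetAt a t) < ∞ := fun s t =>
    (measure_mono Set.sdiff_subset).trans_lt (volume_trawlSetAt_lt_top ha s)
  have h1 := key (fun q => q.1 = k + 1)
    (trawlSetAt a ((k + 1 : ℕ) * Δ) \ trawlSetAt a (k * Δ)) (fin _ _) (fun q hq p hp => by
      obtain ⟨c1, c2, c3⟩ := hp
      exact ⟨(c3 (k + 1) hk).2 (by omega), fun h => by
        have := (c3 k (by omega)).1 h
        omega⟩)
  have h2 := key (fun q => q.2 = k)
    (trawlSetAt a (k * Δ) \ trawlSetAt a ((k + 1 : ℕ) * Δ)) (fin _ _) (fun q hq p hp => by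
      obtain ⟨c1, c2, c3⟩ := hp
      exact ⟨(c3 k (by omega)).2 (by omega), fun h => by
        have := (c3 (k + 1) hk).1 h
        omega⟩)
  have h3 := volume_real_trawlSetAt_diff_le ha hle
  have h4 := volume_real_trawlSetAt_diff_le' ha hle
  rw [hd] at h3 h4
  calc _ ≤ ∑ q ∈ cellIndex N, ((if q.1 = k + 1 then 1 else 0) * volume.real (trawlCell a Δ N q)
        + (if q.2 = k then 1 else 0) * volume.real (trawlCell a Δ N q)) := by
        refine Finset.sum_le_sum fun q _ => ?_
        rw [← add_mul]
        exact mul_le_mul_of_nonneg_right (abs_incrementCoeff_le k q) measureReal_nonneg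
    _ ≤ 2 * a 0 * Δ := by rw [Finset.sum_add_distrib]; linarith

/-- The area of the cell shared by two increments at lag `j`. -/
lemma volume_real_lag_cell_bounds (ha : IsTrawlFunction a) (hΔ : 0 < Δ) {j k : ℕ} (hj : 1 ≤ j)
    (hjk : j ≤ k) (hk : k + 1 < N) {m M : ℝ} (hm0 : 0 ≤ m)
    (hm : ∀ x, (j - 1) * Δ ≤ x → x ≤ j * Δ → m * Δ ≤ a x - a (x + Δ))
    (hM : ∀ x, (j - 1) * Δ ≤ x → x ≤ j * Δ → a x - a (x + Δ) ≤ M * Δ) :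
    m * Δ ^ 2 ≤ volume.real (trawlCell a Δ N (k - j + 1, k))
      ∧ volume.real (trawlCell a Δ N (k - j + 1, k)) ≤ M * Δ ^ 2 := by
  have hj' : (1 : ℝ) ≤ j := by exact_mod_cast hj
  have hcast : ((k - j : ℕ) : ℝ) = k - j := Nat.cast_sub hjk
  have hx : ∀ r, (k - j : ℝ) * Δ < r → r ≤ (k - j + 1) * Δ →
      (j - 1) * Δ ≤ k * Δ - r ∧ k * Δ - r ≤ j * Δ ∧ 0 ≤ k * Δ - r := by
    intro r h1 h2
    have : 0 ≤ (j - 1 : ℝ) * Δ := mul_nonneg (by linarith) hΔ.le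
    refine ⟨by linarith, by linarith, by linarith⟩
  -- The horizontal condition encodes entry during step `k - j`; the vertical one encodes presence
  -- at time `kΔ` and absence at `(k+1)Δ`.
  have hiff : ∀ p : ℝ × ℝ, p ∈ trawlCell a Δ N (k - j + 1, k)
      ↔ ((k - j : ℝ) * Δ < p.1 ∧ p.1 ≤ (k - j + 1) * Δ)
        ∧ a ((k * Δ - p.1) + Δ) < p.2 ∧ p.2 ≤ a (k * Δ - p.1) := by
    intro p
    constructor
    · rintro ⟨h1, h2, h3⟩
      have c1 := (h3 k (by omega)).2 (by simp; omega)
      have c2 := (h3 (k - j + 1) (by omega)).2 (by simp; omega)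
      have c3 : p ∉ trawlSetAt a ((k - j : ℕ) * Δ) := fun h => by
        have := (h3 (k - j) (by omega)).1 h
        simp at this
      have c4 : p ∉ trawlSetAt a ((k + 1 : ℕ) * Δ) := fun h => by
        have := (h3 (k + 1) (by omega)).1 h
        simp at this
      have c5 : (k - j : ℝ) * Δ < p.1 := by
        by_contra h
        refine c3 (mem_trawlSetAt_of_le ha ?_ c1 (by rw [hcast]; linarith))
        exact mul_le_mul_of_nonneg_right (by simp) hΔ.le
      rw [mem_trawlSetAt] at c1 c2
      rw [mem_trawlSetAt] at c4
      have c6 := c2.1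
      push_cast [hcast] at c6 c4
      have e : ((k : ℝ) + 1) * Δ - p.1 = k * Δ - p.1 + Δ := by ring
      rw [e] at c4
      refine ⟨⟨c5, c6⟩, ?_, c1.2.2⟩
      by_contra h
      exact c4 ⟨by linarith [c1.1], c1.2.1, not_lt.1 h⟩
    · rintro ⟨⟨h1, h2⟩, h3, h4⟩
      obtain ⟨x1, x2, x3⟩ := hx p.1 h1 h2
      have hp0 : 0 ≤ p.2 := (ha.nonneg _ (by linarith)).trans h3.le
      refine ⟨by simp; omega, by simp; omega, fun l hl => ⟨fun h => ?_, fun h => ?_⟩⟩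
      · rw [mem_trawlSetAt] at h
        constructor
        · by_contra hc
          have : (l : ℝ) ≤ k - j := by
            rw [← hcast]; exact_mod_cast (by simp at hc; omega : l ≤ k - j)
          have := mul_le_mul_of_nonneg_right this hΔ.le
          linarith [h.1]
        · by_contra hc
          have : (k : ℝ) + 1 ≤ l := by exact_mod_cast (by simp at hc; omega : k + 1 ≤ l)
          have := mul_le_mul_of_nonneg_right this hΔ.le
          have := ha.antitoneOn (show (k * Δ - p.1 + Δ) ∈ Set.Ici 0 from Set.mem_Ici.2 (by linarith))
            (Set.mem_Ici.2 (by linarith)) (show k * Δ - p.1 + Δ ≤ l * Δ - p.1 by linarith)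
          linarith [h.2.2]
      · simp only at h
        refine mem_trawlSetAt_of_le ha (mul_le_mul_of_nonneg_right (Nat.cast_le.2 h.2) hΔ.le)
          (mem_trawlSetAt.2 ⟨by linarith, hp0, h4⟩) (h2.trans ?_)
        have : (k : ℝ) - j + 1 ≤ l := by rw [← hcast]; exact_mod_cast h.1
        exact mul_le_mul_of_nonneg_right this hΔ.le
  -- Comparing the two bounds at one point gives `m ≤ M`, which removes the `max` in the area
  -- estimate.
  have hM0 : 0 ≤ M := by
    have h1 := (hm (j * Δ) (by linarith) le_rfl).trans (hM (j * Δ) (by linarith) le_rfl)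
    have := le_of_mul_le_mul_right h1 hΔ
    linarith
  have h := volume_real_between_bounds (measurableSet_trawlCell ha _) (m := m * Δ) (M := M * Δ)
    (mul_le_mul_of_nonneg_right (by linarith : (k - j : ℝ) ≤ k - j + 1) hΔ.le)
    (mul_nonneg hm0 hΔ.le) hiff
    (fun r h1 h2 => hm _ (hx r h1 h2).1 (hx r h1 h2).2.1)
    (fun r h1 h2 => hM _ (hx r h1 h2).1 (hx r h1 h2).2.1)
  rw [max_eq_left (mul_nonneg hM0 hΔ.le)] at h
  constructor
  · refine le_trans (le_of_eq ?_) h.1; ring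
  · refine h.2.trans (le_of_eq ?_); ring

variable {φ : ℝ → ℝ}

lemma HasTrawlDensity.integrableOn (hφ : HasTrawlDensity a φ) : IntegrableOn φ (Set.Ici 0) := by
  obtain ⟨α, hα, hO⟩ := hφ.decay
  refine LocallyIntegrableOn.integrableOn_of_isBigO_atTop
    (hφ.continuousOn.locallyIntegrableOn measurableSet_Ici) hO ?_
  exact ⟨Set.Ioi 1, Ioi_mem_atTop 1, integrableOn_Ioi_rpow_of_lt (by linarith) one_pos⟩

lemma HasTrawlDensity.sub_eq (hφ : HasTrawlDensity a φ) {x y : ℝ} (hx : 0 ≤ x) (hxy : x ≤ y) :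
    a x - a y = ∫ s in x..y, φ s := by
  have hi := hφ.integrableOn
  rw [hφ.eq_integral x hx, hφ.eq_integral y (hx.trans hxy),
    intervalIntegral.integral_of_le hxy, ← Set.Ioc_union_Ioi_eq_Ioi hxy,
    setIntegral_union (Set.Ioc_disjoint_Ioi le_rfl) measurableSet_Ioi
      (hi.mono_set fun s hs => hx.trans hs.1.le)
      (hi.mono_set fun s hs => (hx.trans hxy).trans (Set.mem_Ioi.1 hs).le)]
  ring

lemma HasTrawlDensity.sub_bounds (hφ : HasTrawlDensity a φ) {x h m M : ℝ} (hx : 0 ≤ x)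
    (hh : 0 ≤ h) (hm : ∀ s, x ≤ s → s ≤ x + h → m ≤ φ s)
    (hM : ∀ s, x ≤ s → s ≤ x + h → φ s ≤ M) :
    m * h ≤ a x - a (x + h) ∧ a x - a (x + h) ≤ M * h := by
  have hle : x ≤ x + h := by linarith
  have hi : IntervalIntegrable φ volume x (x + h) := by
    refine (hφ.integrableOn.mono_set fun s hs => ?_).intervalIntegrable
    rw [Set.uIcc_of_le hle] at hs
    exact hx.trans hs.1
  rw [hφ.sub_eq hx hle]
  constructor
  · have := intervalIntegral.integral_mono_on hle (by simp) hi
      (fun s hs => hm s hs.1 hs.2)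
    simpa [mul_comm] using this
  · have := intervalIntegral.integral_mono_on hle hi (by simp)
      (fun s hs => hM s hs.1 hs.2)
    simpa [mul_comm] using this

lemma HasTrawlDensity.hasDerivWithinAt (hφ : HasTrawlDensity a φ) {t : ℝ} (ht : 0 ≤ t) :
    HasDerivWithinAt a (-φ t) (Set.Ici 0) t := by
  -- This extension of `φ` is continuous on all of `ℝ`, so the two-sided fundamental theorem of
  -- calculus applies even at `t = 0`.
  have hc : Continuous fun x => φ (max x 0) :=
    hφ.continuousOn.comp_continuous (by fun_prop) fun x => Set.mem_Ici.2 (le_max_right _ _)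
  have hd : HasDerivAt (fun s => ∫ x in (0 : ℝ)..s, φ (max x 0)) (φ (max t 0)) t :=
    hc.integral_hasStrictDerivAt 0 t |>.hasDerivAt
  rw [max_eq_left ht] at hd
  have he : ∀ s ∈ Set.Ici (0 : ℝ), a s = a 0 - ∫ x in (0 : ℝ)..s, φ (max x 0) := by
    intro s hs
    have h := hφ.sub_eq le_rfl hs
    have h2 : ∫ x in (0 : ℝ)..s, φ (max x 0) = ∫ x in (0 : ℝ)..s, φ x := by
      refine intervalIntegral.integral_congr fun x hx => ?_
      rw [Set.uIcc_of_le hs] at hx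
      simp only [max_eq_left hx.1]
    rw [h2, ← h]; ring
  exact (hd.const_sub (a 0)).hasDerivWithinAt.congr he (he t ht)

end TrawlGeometry

/-! ### Covariances of the increments and the variance of lagged products -/

section TrawlVariance

variable {Ω : Type*} [MeasurableSpace Ω] {P : Measure Ω} [IsProbabilityMeasure P]
  {T : LevyTriplet} {L : Set (ℝ × ℝ) → Ω → ℝ} {κ : Measure ℝ} {a : ℝ → ℝ} {Δ : ℝ} {N : ℕ}

lemma memLp_two_mul {A B : Ω → ℝ} (hA : MemLp A 4 P) (hB : MemLp B 4 P) :
    MemLp (fun ω => A ω * B ω) 2 P := by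
  refine (memLp_two_iff_integrable_sq
    (hA.aestronglyMeasurable.mul hB.aestronglyMeasurable)).2 ?_
  refine (integrable_mul_four hA hB hA hB).congr (Eventually.of_forall fun ω => ?_)
  simp only [Pi.mul_apply]; ring

/-- The representation of `δ_k X` through the centred values of `L` at the cells. -/
def cellIncrement (P : Measure Ω) (L : Set (ℝ × ℝ) → Ω → ℝ) (a : ℝ → ℝ) (Δ : ℝ) (N k : ℕ)
    (ω : Ω) : ℝ :=
  ∑ q ∈ cellIndex N, incrementCoeff k q * centredBasis P L (trawlCell a Δ N q) ω

/-- The covariance of the increments `δ_k X` and `δ_m X`. -/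
def cellCov (a : ℝ → ℝ) (Δ : ℝ) (N k m : ℕ) : ℝ :=
  ∑ q ∈ cellIndex N, incrementCoeff k q * incrementCoeff m q * volume.real (trawlCell a Δ N q)

namespace IsHomogeneousLevyBasis

lemma ae_trawlProcess (hL : IsHomogeneousLevyBasis P T L) (ha : IsTrawlFunction a) (hΔ : 0 ≤ Δ)
    {k : ℕ} (hk : k < N) :
    ∀ᵐ ω ∂P, trawlProcess L a (k * Δ) ω
      = ∑ q ∈ cellIndex N, (if q.1 ≤ k ∧ k ≤ q.2 then 1 else 0) * L (trawlCell a Δ N q) ω := by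
  have h := hL.ae_biUnion ((cellIndex N).filter fun q => q.1 ≤ k ∧ k ≤ q.2)
    (fun q => measurableSet_trawlCell (Δ := Δ) (N := N) ha q)
    (fun q => volume_trawlCell_lt_top ha q) disjoint_trawlCell
  filter_upwards [h] with ω hω
  rw [trawlProcess, trawlSetAt_eq_biUnion ha hΔ hk, hω, Finset.sum_filter]
  simp only [ite_mul, one_mul, zero_mul]

lemma ae_gridIncrement (hL : IsHomogeneousLevyBasis P T L) (hκ : IsLevySeedLaw T κ)
    (hmom : SeedMoments κ) (ha : IsTrawlFunction a) (hΔ : 0 ≤ Δ) {k : ℕ} (hk : k + 1 < N) :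
    ∀ᵐ ω ∂P, gridIncrement (trawlProcess L a) Δ k ω = cellIncrement P L a Δ N k ω := by
  have mA := fun t => measurableSet_trawlSetAt ha t
  have vA := fun t => volume_trawlSetAt_lt_top ha t
  have h : ∀ᵐ ω ∂P, gridIncrement (trawlProcess L a) Δ k ω
      = ∑ q ∈ cellIndex N, incrementCoeff k q * L (trawlCell a Δ N q) ω := by
    filter_upwards [hL.ae_trawlProcess ha hΔ (k := k) (by omega : k < N),
      hL.ae_trawlProcess ha hΔ hk] with ω h1 h2
    push_cast at h2
    rw [gridIncrement, h1, h2, ← Finset.sum_sub_distrib]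
    refine Finset.sum_congr rfl fun q hq => ?_
    rw [← sub_mul]
    congr 1
    have := (mem_cellIndex.1 hq).1
    simp only [incrementCoeff]
    split_ifs <;> first | (exfalso; omega) | norm_num
  have hint : ∀ q, Integrable (L (trawlCell a Δ N q)) P := fun q =>
    integrable_of_memLp_four (hL.memLp_four hκ hmom (measurableSet_trawlCell ha q)
      (volume_trawlCell_lt_top ha q))
  have hX : ∀ t, Integrable (trawlProcess L a t) P := fun t =>
    integrable_of_memLp_four (hL.memLp_four hκ hmom (mA t) (vA t))
  -- Stationarity gives the increment mean zero, so replacing every cell value by its centred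
  -- version changes nothing.
  have hzero : ∑ q ∈ cellIndex N, incrementCoeff k q * ∫ ω, L (trawlCell a Δ N q) ω ∂P = 0 := by
    simp only [← integral_const_mul]
    rw [← integral_finsetSum _ fun q _ => (hint q).const_mul _, ← integral_congr_ae h]
    simp only [gridIncrement]
    rw [integral_sub (hX _) (hX _), sub_eq_zero]
    exact (hL.identDistrib (mA _) (mA _) (vA _) (volume_trawlSetAt_eq _ _)).integral_eq
  filter_upwards [h] with ω hω
  simp only [hω, cellIncrement, centredBasis, mul_sub, Finset.sum_sub_distrib, hzero, sub_zero]

lemma memLp_cellIncrement (hL : IsHomogeneousLevyBasis P T L) (hκ : IsLevySeedLaw T κ)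
    (hmom : SeedMoments κ) (ha : IsTrawlFunction a) (k : ℕ) :
    MemLp (cellIncrement P L a Δ N k) 4 P :=
  memLp_linear_comb (fun q => hL.memLp_centred hκ hmom (measurableSet_trawlCell ha q)
    (volume_trawlCell_lt_top ha q)) _ _

lemma iIndepFun_centred (hL : IsHomogeneousLevyBasis P T L) (ha : IsTrawlFunction a) :
    iIndepFun (fun q => centredBasis P L (trawlCell a Δ N q)) P :=
  (hL.iIndepFun_family (fun q => measurableSet_trawlCell (Δ := Δ) (N := N) ha q)
    (fun q => volume_trawlCell_lt_top ha q) disjoint_trawlCell).comp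
    (fun q x => x - ∫ ω, L (trawlCell a Δ N q) ω ∂P) fun q => by fun_prop

lemma integral_cellIncrement_mul (hL : IsHomogeneousLevyBasis P T L) (hκ : IsLevySeedLaw T κ)
    (hmom : SeedMoments κ) (ha : IsTrawlFunction a) (k m : ℕ) :
    ∫ ω, cellIncrement P L a Δ N k ω * cellIncrement P L a Δ N m ω ∂P = cellCov a Δ N k m := by
  have mC := fun q => measurableSet_trawlCell (Δ := Δ) (N := N) ha q
  have vC := fun q => volume_trawlCell_lt_top (Δ := Δ) (N := N) ha q
  have h := integral_mul_linear_comb (fun q => hL.measurable_centred (mC q) (vC q))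
    (hL.iIndepFun_centred ha) (fun q => hL.memLp_centred hκ hmom (mC q) (vC q))
    (fun q => hL.integral_centred hκ hmom (mC q) (vC q)) (cellIndex N)
    (incrementCoeff k) (incrementCoeff m)
  simp only [fun q => hL.integral_centred_sq hκ hmom (mC q) (vC q)] at h
  exact h

lemma integral_cellIncrement_mul_four (hL : IsHomogeneousLevyBasis P T L)
    (hκ : IsLevySeedLaw T κ) (hmom : SeedMoments κ) (ha : IsTrawlFunction a) {K : ℝ}
    (hK : ∀ A : Set (ℝ × ℝ), MeasurableSet A → volume A < ∞ →
      ∫ ω, centredBasis P L A ω ^ 4 ∂P - 3 * (∫ ω, centredBasis P L A ω ^ 2 ∂P) ^ 2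
        = (volume A).toReal * K) (k l m r : ℕ) :
    ∫ ω, cellIncrement P L a Δ N k ω * cellIncrement P L a Δ N l ω
        * cellIncrement P L a Δ N m ω * cellIncrement P L a Δ N r ω ∂P
      = cellCov a Δ N k l * cellCov a Δ N m r + cellCov a Δ N k m * cellCov a Δ N l r
        + cellCov a Δ N k r * cellCov a Δ N l m
        + ∑ q ∈ cellIndex N, incrementCoeff k q * incrementCoeff l q * incrementCoeff m q
          * incrementCoeff r q * (volume.real (trawlCell a Δ N q) * K) := by
  have mC := fun q => measurableSet_trawlCell (Δ := Δ) (N := N) ha q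
  have vC := fun q => volume_trawlCell_lt_top (Δ := Δ) (N := N) ha q
  have h := integral_mul_four_linear_comb (fun q => hL.measurable_centred (mC q) (vC q))
    (hL.iIndepFun_centred ha) (fun q => hL.memLp_centred hκ hmom (mC q) (vC q))
    (fun q => hL.integral_centred hκ hmom (mC q) (vC q)) (cellIndex N)
    (incrementCoeff k) (incrementCoeff l) (incrementCoeff m) (incrementCoeff r)
  simp only [fun q => hK _ (mC q) (vC q)] at h
  simp only [fun q => hL.integral_centred_sq hκ hmom (mC q) (vC q)] at h
  exact h

end IsHomogeneousLevyBasis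

lemma abs_cellCov_le_sum (k m : ℕ) :
    |cellCov a Δ N k m| ≤ ∑ q ∈ cellIndex N,
      |incrementCoeff m q| * (|incrementCoeff k q| * volume.real (trawlCell a Δ N q)) := by
  refine (Finset.abs_sum_le_sum_abs _ _).trans (le_of_eq (Finset.sum_congr rfl fun q _ => ?_))
  rw [abs_mul, abs_mul, abs_of_nonneg (measureReal_nonneg (μ := volume))]
  ring

lemma abs_cellCov_le (ha : IsTrawlFunction a) (hΔ : 0 ≤ Δ) {k : ℕ} (hk : k + 1 < N) (m : ℕ) :
    |cellCov a Δ N k m| ≤ 2 * a 0 * Δ := by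
  refine (abs_cellCov_le_sum k m).trans
    ((Finset.sum_le_sum fun q _ => ?_).trans (sum_abs_incrementCoeff_mul_volume_le ha hΔ hk))
  exact mul_le_of_le_one_left (mul_nonneg (abs_nonneg _) measureReal_nonneg)
    (abs_incrementCoeff_le_one m q)

/-- Each cell is seen by at most two increments, so summing over all `m` costs only a factor `2`
over the area bound for one increment. This absolute summability keeps the variance linear in the
number of terms. -/
lemma sum_abs_cellCov_le (ha : IsTrawlFunction a) (hΔ : 0 ≤ Δ) {k : ℕ} (hk : k + 1 < N)
    (s : Finset ℕ) : ∑ m ∈ s, |cellCov a Δ N k m| ≤ 2 * (2 * a 0 * Δ) := by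
  refine (Finset.sum_le_sum fun m _ => abs_cellCov_le_sum k m).trans ?_
  rw [Finset.sum_comm]
  simp only [← Finset.sum_mul]
  refine (Finset.sum_le_sum fun q _ => mul_le_mul_of_nonneg_right
    (sum_abs_incrementCoeff_le s q) (mul_nonneg (abs_nonneg _) measureReal_nonneg)).trans ?_
  rw [← Finset.mul_sum]
  exact mul_le_mul_of_nonneg_left (sum_abs_incrementCoeff_mul_volume_le ha hΔ hk) zero_le_two

lemma sum_abs_cellCov_sub_le (ha : IsTrawlFunction a) (hΔ : 0 ≤ Δ) {k j : ℕ} (hk : k + 1 < N)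
    {s : Finset ℕ} (hs : ∀ m ∈ s, j ≤ m) :
    ∑ m ∈ s, |cellCov a Δ N k (m - j)| ≤ 2 * (2 * a 0 * Δ) := by
  refine le_trans (le_of_eq ?_) (sum_abs_cellCov_le ha hΔ hk (s.image fun m => m - j))
  rw [Finset.sum_image]
  intro x hx y hy hxy
  have := hs x hx
  have := hs y hy
  simp only at hxy
  omega

lemma cellCov_lag {j k : ℕ} (hj : 1 ≤ j) (hk : j ≤ k) (hkN : k < N) :
    cellCov a Δ N k (k - j) = -volume.real (trawlCell a Δ N (k - j + 1, k)) := by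
  have h : ∀ q ∈ cellIndex N, incrementCoeff k q * incrementCoeff (k - j) q
      * volume.real (trawlCell a Δ N q)
      = if q = (k - j + 1, k) then -volume.real (trawlCell a Δ N q) else 0 := fun q hq => by
    rw [incrementCoeff_mul_lag hj hk (mem_cellIndex.1 hq).1]
    split_ifs <;> simp
  rw [cellCov, Finset.sum_congr rfl h, Finset.sum_ite_eq',
    if_pos (mem_cellIndex.2 ⟨by simp; omega, hkN⟩)]

/-- A lagged pair shares one cell and distinct pairs share none, so the cumulant term lives on the
diagonal, where the coefficient is `(-1)² = 1`. -/
lemma sum_fourth_cumulant_eq {j k m : ℕ} (hj : 1 ≤ j) (hk : j ≤ k) (hm : j ≤ m) (hkN : k < N)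
    (K : ℝ) :
    ∑ q ∈ cellIndex N, incrementCoeff k q * incrementCoeff (k - j) q * incrementCoeff m q
        * incrementCoeff (m - j) q * (volume.real (trawlCell a Δ N q) * K)
      = if m = k then volume.real (trawlCell a Δ N (k - j + 1, k)) * K else 0 := by
  by_cases hkm : m = k
  · subst hkm
    have h : ∀ q ∈ cellIndex N, incrementCoeff m q * incrementCoeff (m - j) q
        * incrementCoeff m q * incrementCoeff (m - j) q * (volume.real (trawlCell a Δ N q) * K)
        = if q = (m - j + 1, m) then volume.real (trawlCell a Δ N q) * K else 0 := fun q hq => by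
      rw [mul_assoc (_ * _) (incrementCoeff m q),
        incrementCoeff_mul_lag hj hk (mem_cellIndex.1 hq).1]
      split_ifs <;> simp
    rw [Finset.sum_congr rfl h, Finset.sum_ite_eq', if_pos rfl,
      if_pos (mem_cellIndex.2 ⟨by simp; omega, hkN⟩)]
  · rw [if_neg hkm]
    exact Finset.sum_eq_zero fun q _ => by
      rw [incrementCoeff_mul_four_eq_zero hj hk hm (Ne.symm hkm) q, zero_mul]

/-- The variance of a sum of lagged products of increments. -/
lemma IsHomogeneousLevyBasis.variance_sum_le (hL : IsHomogeneousLevyBasis P T L)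
    (hκ : IsLevySeedLaw T κ) (hmom : SeedMoments κ) (ha : IsTrawlFunction a) (hΔ : 0 ≤ Δ) {K : ℝ}
    (hK : ∀ A : Set (ℝ × ℝ), MeasurableSet A → volume A < ∞ →
      ∫ ω, centredBasis P L A ω ^ 4 ∂P - 3 * (∫ ω, centredBasis P L A ω ^ 2 ∂P) ^ 2
        = (volume A).toReal * K)
    {j : ℕ} (hj : 1 ≤ j) {s : Finset ℕ} (hs : ∀ k ∈ s, j ≤ k ∧ k + 1 < N) {V : ℝ}
    (hV : ∀ k ∈ s, volume.real (trawlCell a Δ N (k - j + 1, k)) ≤ V) :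
    Var[fun ω => ∑ k ∈ s, cellIncrement P L a Δ N k ω * cellIncrement P L a Δ N (k - j) ω; P]
      ≤ s.card * (4 * (2 * a 0 * Δ) ^ 2 + V * |K|) := by
  have hD := fun k => hL.memLp_cellIncrement (Δ := Δ) (N := N) hκ hmom ha k
  have hS : MemLp (fun ω => ∑ k ∈ s,
      cellIncrement P L a Δ N k ω * cellIncrement P L a Δ N (k - j) ω) 2 P :=
    memLp_finsetSum s fun k _ => memLp_two_mul (hD k) (hD (k - j))
  have h1 : ∫ ω, ∑ k ∈ s, cellIncrement P L a Δ N k ω * cellIncrement P L a Δ N (k - j) ω ∂P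
      = ∑ k ∈ s, cellCov a Δ N k (k - j) := by
    rw [integral_finsetSum _ fun k _ => integrable_mul_two (hD k) (hD (k - j))]
    exact Finset.sum_congr rfl fun k _ => hL.integral_cellIncrement_mul hκ hmom ha k (k - j)
  have h2 : ∫ ω, (∑ k ∈ s, cellIncrement P L a Δ N k ω * cellIncrement P L a Δ N (k - j) ω) ^ 2 ∂P
      = ∑ k ∈ s, ∑ m ∈ s, (cellCov a Δ N k (k - j) * cellCov a Δ N m (m - j)
        + (cellCov a Δ N k m * cellCov a Δ N (k - j) (m - j)
        + cellCov a Δ N k (m - j) * cellCov a Δ N (k - j) m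
        + if m = k then volume.real (trawlCell a Δ N (k - j + 1, k)) * K else 0)) := by
    simp only [pow_two, Finset.sum_mul_sum, ← mul_assoc]
    rw [integral_finsetSum _ fun k _ => integrable_finsetSum _ fun m _ =>
      integrable_mul_four (hD k) (hD (k - j)) (hD m) (hD (m - j))]
    refine Finset.sum_congr rfl fun k hk => ?_
    rw [integral_finsetSum _ fun m _ =>
      integrable_mul_four (hD k) (hD (k - j)) (hD m) (hD (m - j))]
    refine Finset.sum_congr rfl fun m hm => ?_
    rw [hL.integral_cellIncrement_mul_four hκ hmom ha hK,
      sum_fourth_cumulant_eq hj (hs k hk).1 (hs m hm).1 (by have := (hs k hk).2; omega) K]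
    ring
  rw [variance_eq_sub hS]
  simp only [Pi.pow_apply]
  rw [h1, h2, pow_two, Finset.sum_mul_sum, ← Finset.sum_sub_distrib]
  -- The pairing of each product with itself cancels against the squared mean.
  simp only [← Finset.sum_sub_distrib, add_sub_cancel_left]
  rw [← nsmul_eq_mul]
  refine Finset.sum_le_card_nsmul _ _ _ fun k hk => ?_
  have hk1 : k + 1 < N := (hs k hk).2
  have hk2 : k - j + 1 < N := by omega
  have hW : 0 ≤ 2 * a 0 * Δ := mul_nonneg (mul_nonneg zero_le_two (ha.nonneg 0 le_rfl)) hΔ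
  rw [Finset.sum_add_distrib, Finset.sum_add_distrib, Finset.sum_ite_eq', if_pos hk]
  -- In each mixed pairing one covariance is bounded uniformly and the other is summed over `m`.
  have b1 : ∑ m ∈ s, cellCov a Δ N k m * cellCov a Δ N (k - j) (m - j)
      ≤ 2 * (2 * a 0 * Δ) ^ 2 := by
    calc _ ≤ ∑ m ∈ s, (2 * a 0 * Δ) * |cellCov a Δ N (k - j) (m - j)| := by
          refine Finset.sum_le_sum fun m _ => (le_abs_self _).trans ?_
          rw [abs_mul]
          exact mul_le_mul_of_nonneg_right (abs_cellCov_le ha hΔ hk1 m) (abs_nonneg _)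
      _ ≤ (2 * a 0 * Δ) * (2 * (2 * a 0 * Δ)) := by
          rw [← Finset.mul_sum]
          exact mul_le_mul_of_nonneg_left
            (sum_abs_cellCov_sub_le ha hΔ hk2 fun m hm => (hs m hm).1) hW
      _ = _ := by ring
  have b2 : ∑ m ∈ s, cellCov a Δ N k (m - j) * cellCov a Δ N (k - j) m
      ≤ 2 * (2 * a 0 * Δ) ^ 2 := by
    calc _ ≤ ∑ m ∈ s, (2 * a 0 * Δ) * |cellCov a Δ N (k - j) m| := by
          refine Finset.sum_le_sum fun m _ => (le_abs_self _).trans ?_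
          rw [abs_mul]
          exact mul_le_mul_of_nonneg_right (abs_cellCov_le ha hΔ hk1 (m - j)) (abs_nonneg _)
      _ ≤ (2 * a 0 * Δ) * (2 * (2 * a 0 * Δ)) := by
          rw [← Finset.mul_sum]
          exact mul_le_mul_of_nonneg_left (sum_abs_cellCov_le ha hΔ hk2 s) hW
      _ = _ := by ring
  have b3 : volume.real (trawlCell a Δ N (k - j + 1, k)) * K ≤ V * |K| :=
    (mul_le_mul_of_nonneg_left (le_abs_self K) measureReal_nonneg).trans
      (mul_le_mul_of_nonneg_right (hV k hk) (abs_nonneg _))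
  linarith

end TrawlVariance

/-! ### Mean and fluctuation of the derivative estimator -/

section TrawlEstimator

variable {Ω : Type*} [MeasurableSpace Ω] {P : Measure Ω} [IsProbabilityMeasure P]
  {T : LevyTriplet} {L : Set (ℝ × ℝ) → Ω → ℝ} {κ : Measure ℝ} {a φ : ℝ → ℝ}

/-- Near the lag `t`, the shared cells have area asymptotic to `φ(t) Δ²`, uniformly. -/
lemma exists_cell_volume_bounds (ha : IsTrawlFunction a) (hφ : HasTrawlDensity a φ) {t : ℝ}
    (ht : 0 ≤ t) {ε : ℝ} (hε : 0 < ε) :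
    ∃ δ > 0, ∀ Δ : ℝ, 0 < Δ → Δ < δ → ∀ N k : ℕ, ⌊t / Δ⌋₊ + 1 ≤ k → k + 1 < N →
      |volume.real (trawlCell a Δ N (k - (⌊t / Δ⌋₊ + 1) + 1, k)) - φ t * Δ ^ 2| ≤ ε * Δ ^ 2 := by
  have hpos := hφ.pos t ht
  -- Capping at `φ t` keeps the lower bound `φ t - ε'` nonnegative, as the area estimate requires.
  set ε' := min ε (φ t) with hε'
  have hε'0 : 0 < ε' := lt_min hε hpos
  obtain ⟨δ, hδ, hc⟩ := Metric.continuousWithinAt_iff.1 (hφ.continuousOn t ht) ε' hε'0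
  -- The values of `φ` involved lie over `[lΔ, (l+2)Δ]`, hence within `2Δ` of `t`.
  refine ⟨δ / 2, half_pos hδ, fun Δ hΔ hΔδ N k hk hkN => ?_⟩
  have hl1 : (⌊t / Δ⌋₊ : ℝ) * Δ ≤ t := (le_div_iff₀ hΔ).1 (Nat.floor_le (div_nonneg ht hΔ.le))
  have hl2 : t < (⌊t / Δ⌋₊ + 1) * Δ := (div_lt_iff₀ hΔ).1 (Nat.lt_floor_add_one _)
  have hl0 : 0 ≤ (⌊t / Δ⌋₊ : ℝ) * Δ := mul_nonneg (Nat.cast_nonneg _) hΔ.le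
  have hφs : ∀ s, ⌊t / Δ⌋₊ * Δ ≤ s → s ≤ (⌊t / Δ⌋₊ + 2) * Δ →
      φ t - ε' ≤ φ s ∧ φ s ≤ φ t + ε' := fun s h1 h2 => by
    have h3 := hc (Set.mem_Ici.2 (hl0.trans h1)) (by
      rw [Real.dist_eq, abs_lt]; constructor <;> linarith)
    rw [Real.dist_eq, abs_lt] at h3
    constructor <;> linarith [h3.1, h3.2]
  have hb : ∀ x, ((⌊t / Δ⌋₊ + 1 : ℕ) - 1 : ℝ) * Δ ≤ x → x ≤ (⌊t / Δ⌋₊ + 1 : ℕ) * Δ →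
      (φ t - ε') * Δ ≤ a x - a (x + Δ) ∧ a x - a (x + Δ) ≤ (φ t + ε') * Δ := fun x h1 h2 => by
    push_cast at h1 h2
    rw [add_sub_cancel_right] at h1
    exact hφ.sub_bounds (hl0.trans h1) hΔ.le
      (fun s hs1 hs2 => (hφs s (h1.trans hs1) (by linarith)).1)
      (fun s hs1 hs2 => (hφs s (h1.trans hs1) (by linarith)).2)
  have h := volume_real_lag_cell_bounds (N := N) ha hΔ (Nat.le_add_left 1 _) hk hkN
    (sub_nonneg.2 (min_le_right _ _)) (fun x h1 h2 => (hb x h1 h2).1)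
    (fun x h1 h2 => (hb x h1 h2).2)
  have hle : ε' * Δ ^ 2 ≤ ε * Δ ^ 2 := mul_le_mul_of_nonneg_right (min_le_left _ _) (sq_nonneg _)
  rw [abs_le]
  constructor <;> linarith [h.1, h.2]

/-- The mean of the derivative estimator. -/
def derivEstimatorMean (a : ℝ → ℝ) (Δ : ℝ) (n : ℕ) (t : ℝ) : ℝ :=
  1 / (n * Δ ^ 2) * ∑ k ∈ Finset.Icc (⌊t / Δ⌋₊ + 1) (n - 2), cellCov a Δ n k (k - (⌊t / Δ⌋₊ + 1))

/-- For `n ≤ 1` the truncated `n - 2` is `0` and the window is empty, so the strict bound holds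
there too. -/
lemma lag_window {l n k : ℕ} (hk : k ∈ Finset.Icc (l + 1) (n - 2)) : l + 1 ≤ k ∧ k + 1 < n := by
  rw [Finset.mem_Icc] at hk
  omega

lemma tendsto_derivEstimatorMean (ha : IsTrawlFunction a) (hφ : HasTrawlDensity a φ)
    {Δ : ℕ → ℝ} {μ : ℝ≥0∞} (hΔ : SamplingScheme Δ μ) {t : ℝ} (ht : 0 ≤ t) :
    Tendsto (fun n => derivEstimatorMean a (Δ n) n t) atTop (𝓝 (-φ t)) := by
  have hpos := hφ.pos t ht
  have hfrac : Tendsto (fun n : ℕ => (2 : ℝ) / n + t / (n * Δ n)) atTop (𝓝 0) := by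
    simpa using (tendsto_const_div_atTop_nhds_zero_nat (2 : ℝ)).add
      (tendsto_const_nhds.div_atTop hΔ.tendsto_span)
  rw [Metric.tendsto_nhds]
  intro ε hε
  obtain ⟨δ, hδ, hcell⟩ := exists_cell_volume_bounds ha hφ ht (half_pos (half_pos hε))
  have hev : ∀ᶠ n : ℕ in atTop, φ t * ((2 : ℝ) / n + t / (n * Δ n)) < ε / 2 := by
    have := hfrac.const_mul (φ t)
    rw [mul_zero] at this
    exact this.eventually_lt_const (half_pos hε)
  filter_upwards [hΔ.tendsto_zero.eventually_lt_const hδ, hev, eventually_ge_atTop 1]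
    with n hn1 hn2 hn3
  have hD := hΔ.pos n
  have hn : (0 : ℝ) < n := by exact_mod_cast hn3
  set l := ⌊t / Δ n⌋₊ with hl
  set s := Finset.Icc (l + 1) (n - 2) with hs
  have hcard1 : (s.card : ℝ) ≤ n := by
    rw [hs, Nat.card_Icc]; exact_mod_cast (by omega)
  have hcard2 : (n : ℝ) ≤ s.card + (2 + l) := by
    rw [hs, Nat.card_Icc]; exact_mod_cast (by omega)
  have hl1 : (l : ℝ) ≤ t / Δ n := Nat.floor_le (div_nonneg ht hD.le)
  have hsum : |∑ k ∈ s, cellCov a (Δ n) n k (k - (l + 1)) + s.card * (φ t * Δ n ^ 2)|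
      ≤ n * (ε / 2 / 2 * Δ n ^ 2) := by
    rw [← nsmul_eq_mul, ← Finset.sum_const, ← Finset.sum_add_distrib]
    refine (Finset.abs_sum_le_sum_abs _ _).trans ((Finset.sum_le_card_nsmul s _
      (ε / 2 / 2 * Δ n ^ 2) fun k hk => ?_).trans ?_)
    · obtain ⟨h1, h2⟩ := lag_window hk
      rw [cellCov_lag (by omega) h1 (by omega), neg_add_eq_sub, abs_sub_comm]
      exact hcell (Δ n) hD hn1 n k h1 h2
    · rw [nsmul_eq_mul]
      exact mul_le_mul_of_nonneg_right hcard1 (by positivity)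
  have hq : 0 < n * Δ n ^ 2 := by positivity
  have hle : |derivEstimatorMean a (Δ n) n t - -φ t| ≤ ε / 2 / 2 + φ t * (2 / n + t / (n * Δ n)) := by
    -- The error splits into the deviation of the summands from `-φ t * Δ²` and the proportion of
    -- the `n` summands that are missing.
    have e : derivEstimatorMean a (Δ n) n t - -φ t
        = (∑ k ∈ s, cellCov a (Δ n) n k (k - (l + 1)) + s.card * (φ t * Δ n ^ 2)) / (n * Δ n ^ 2)
          + φ t * (1 - s.card / n) := by
      rw [derivEstimatorMean]
      field_simp
      ring
    rw [e]
    refine (abs_add_le _ _).trans (add_le_add ?_ ?_)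
    · rw [abs_div, abs_of_pos hq, div_le_iff₀ hq]
      exact hsum.trans (le_of_eq (by ring))
    · rw [abs_mul, abs_of_pos hpos]
      refine mul_le_mul_of_nonneg_left ?_ hpos.le
      have h1 : (s.card : ℝ) / n ≤ 1 := (div_le_one hn).2 hcard1
      rw [abs_of_nonneg (by linarith)]
      have e2 : (2 : ℝ) / n + t / (n * Δ n) = (2 + t / Δ n) / n := by field_simp
      rw [e2, sub_le_iff_le_add, ← add_div, le_div_iff₀ hn]
      linarith
  rw [Real.dist_eq]
  linarith

lemma IsHomogeneousLevyBasis.ae_derivEstimator (hL : IsHomogeneousLevyBasis P T L)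
    (hκ : IsLevySeedLaw T κ) (hmom : SeedMoments κ) (ha : IsTrawlFunction a) {Δ : ℝ}
    (hΔ : 0 ≤ Δ) (n : ℕ) (t : ℝ) :
    ∀ᵐ ω ∂P, derivEstimator (trawlProcess L a) Δ n t ω
      = 1 / (n * Δ ^ 2) * ∑ k ∈ Finset.Icc (⌊t / Δ⌋₊ + 1) (n - 2),
        cellIncrement P L a Δ n k ω * cellIncrement P L a Δ n (k - (⌊t / Δ⌋₊ + 1)) ω := by
  have h : ∀ᵐ ω ∂P, ∀ k, k + 1 < n →
      gridIncrement (trawlProcess L a) Δ k ω = cellIncrement P L a Δ n k ω :=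
    ae_all_iff.2 fun k => by
      by_cases hk : k + 1 < n
      · exact (hL.ae_gridIncrement hκ hmom ha hΔ hk).mono fun ω h _ => h
      · exact Eventually.of_forall fun ω h => absurd h hk
  filter_upwards [h] with ω hω
  rw [derivEstimator]
  congr 1
  refine Finset.sum_congr rfl fun k hk => ?_
  obtain ⟨h1, h2⟩ := lag_window hk
  rw [Nat.sub_sub, hω k h2, hω _ (by omega)]

/-- The centred derivative estimator is of order `1 / √(nΔ²)` in probability. -/
lemma IsHomogeneousLevyBasis.isBigOInProbability_derivEstimator
    (hL : IsHomogeneousLevyBasis P T L) (hκ : IsLevySeedLaw T κ) (hmom : SeedMoments κ)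
    (ha : IsTrawlFunction a) (hφ : HasTrawlDensity a φ) {Δ : ℕ → ℝ} {μ : ℝ≥0∞}
    (hΔ : SamplingScheme Δ μ) {t : ℝ} (ht : 0 ≤ t) :
    IsBigOInProbability P (fun n ω => derivEstimator (trawlProcess L a) (Δ n) n t ω
      - derivEstimatorMean a (Δ n) n t) (fun n => 1 / √(n * Δ n ^ 2)) := by
  obtain ⟨K, hK⟩ := hL.exists_fourth_cumulant hκ hmom
  obtain ⟨δ, hδ, hcell⟩ := exists_cell_volume_bounds ha hφ ht one_pos
  -- The variance bound per summand is `C * Δ²`: `16 * a 0 ^ 2` is `4 * (2 * a 0) ^ 2` from the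
  -- pairings, and `φ t + 1` bounds the shared cell area divided by `Δ²`.
  set C : ℝ := 16 * a 0 ^ 2 + (φ t + 1) * |K| with hC
  have hφt := hφ.pos t ht
  have hC0 : 0 ≤ C := by positivity
  intro ε hε
  -- Chebyshev's inequality yields `C / M²`, which this `M` makes at most `ε`; the `+ 1` keeps `M`
  -- positive if `C = 0`.
  refine ⟨√((C + 1) / ε), Real.sqrt_pos.2 (by positivity), ?_⟩
  filter_upwards [hΔ.tendsto_zero.eventually_lt_const hδ, eventually_ge_atTop 1] with n hn1 hn3
  have hD := hΔ.pos n
  have hn : (0 : ℝ) < n := by exact_mod_cast hn3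
  have hq : 0 < n * Δ n ^ 2 := by positivity
  set l := ⌊t / Δ n⌋₊ with hl
  set s := Finset.Icc (l + 1) (n - 2) with hs
  have hcard : (s.card : ℝ) ≤ n := by
    rw [hs, Nat.card_Icc]; exact_mod_cast (by omega)
  set S : Ω → ℝ := fun ω => ∑ k ∈ s,
    cellIncrement P L a (Δ n) n k ω * cellIncrement P L a (Δ n) n (k - (l + 1)) ω with hS
  have hmem := fun k => hL.memLp_cellIncrement (Δ := Δ n) (N := n) hκ hmom ha k
  have hS2 : MemLp S 2 P := memLp_finsetSum s fun k _ => memLp_two_mul (hmem k) (hmem _)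
  have hmean : ∫ ω, S ω ∂P = ∑ k ∈ s, cellCov a (Δ n) n k (k - (l + 1)) := by
    rw [hS, integral_finsetSum _ fun k _ => integrable_mul_two (hmem k) (hmem _)]
    exact Finset.sum_congr rfl fun k _ => hL.integral_cellIncrement_mul hκ hmom ha _ _
  have hvar : Var[S; P] ≤ n * Δ n ^ 2 * C := by
    have h := hL.variance_sum_le hκ hmom ha hD.le hK (Nat.le_add_left 1 l)
      (s := s) (fun k hk => lag_window hk) (V := (φ t + 1) * Δ n ^ 2) fun k hk => by
        obtain ⟨h1, h2⟩ := lag_window hk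
        have := (abs_le.1 (hcell (Δ n) hD hn1 n k h1 h2)).2
        linarith
    refine h.trans ((mul_le_mul_of_nonneg_right hcard (by positivity)).trans (le_of_eq ?_))
    rw [hC]; ring
  set M := √((C + 1) / ε) with hM
  have hM0 : 0 < M := Real.sqrt_pos.2 (by positivity)
  have hsq : 0 < √(n * Δ n ^ 2) := Real.sqrt_pos.2 hq
  have hc : 0 < M * √(n * Δ n ^ 2) := mul_pos hM0 hsq
  have hcheb := meas_ge_le_variance_div_sq hS2 hc
  calc P {ω | M * (1 / √(n * Δ n ^ 2)) < |derivEstimator (trawlProcess L a) (Δ n) n t ω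
          - derivEstimatorMean a (Δ n) n t|}
      ≤ P {ω | M * √(n * Δ n ^ 2) ≤ |S ω - ∫ ω, S ω ∂P|} := by
        refine measure_mono_ae ?_
        filter_upwards [hL.ae_derivEstimator hκ hmom ha hD.le n t] with ω hω hlt
        change M * (1 / √(n * Δ n ^ 2)) < |derivEstimator (trawlProcess L a) (Δ n) n t ω
          - derivEstimatorMean a (Δ n) n t| at hlt
        change M * √(n * Δ n ^ 2) ≤ |S ω - ∫ ω, S ω ∂P|
        rw [hω, derivEstimatorMean, ← hmean, ← mul_sub, abs_mul, abs_of_pos (by positivity),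
          div_mul_eq_mul_div, one_mul, lt_div_iff₀ hq] at hlt
        refine le_trans (le_of_eq ?_) hlt.le
        nth_rewrite 3 [← Real.mul_self_sqrt hq.le]
        field_simp
    _ ≤ ENNReal.ofReal (Var[S; P] / (M * √(n * Δ n ^ 2)) ^ 2) := hcheb
    _ ≤ ENNReal.ofReal ε := by
        refine ENNReal.ofReal_le_ofReal ?_
        rw [div_le_iff₀ (by positivity), mul_pow, Real.sq_sqrt hq.le, hM,
          Real.sq_sqrt (by positivity), ← mul_assoc, mul_div_cancel₀ _ hε.ne']
        have : C * (n * Δ n ^ 2) ≤ (C + 1) * (n * Δ n ^ 2) :=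
          mul_le_mul_of_nonneg_right (by linarith) hq.le
        linarith

/-- A stochastic term `O_P(r_n)` with `r_n → 0` plus a vanishing deterministic term is
negligible in probability. -/
lemma IsBigOInProbability.tendstoInMeasure {R : ℕ → Ω → ℝ} {ρ r : ℕ → ℝ}
    (hR : IsBigOInProbability P R ρ) (hρ : Tendsto ρ atTop (𝓝 0)) (hr : Tendsto r atTop (𝓝 0))
    {Y : ℕ → Ω → ℝ} {c : ℝ} (hY : ∀ n ω, Y n ω = c + R n ω + r n) :
    TendstoInMeasure P Y atTop fun _ => c := by
  rw [tendstoInMeasure_iff_norm]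
  intro ε hε
  rw [ENNReal.tendsto_nhds_zero]
  intro η hη
  -- The tolerance `η` may be infinite, so a positive real below it is used.
  obtain ⟨η', hη'0, hη'⟩ : ∃ η' : ℝ, 0 < η' ∧ ENNReal.ofReal η' ≤ η := by
    obtain ⟨b, hb0, hb⟩ := ENNReal.lt_iff_exists_nnreal_btwn.1 hη
    exact ⟨b, by exact_mod_cast hb0, by simpa using hb.le⟩
  obtain ⟨M, hM, hev⟩ := hR η' hη'0
  have hMρ : ∀ᶠ n in atTop, M * ρ n < ε / 2 := by
    have := hρ.const_mul M
    rw [mul_zero] at this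
    exact this.eventually_lt_const (half_pos hε)
  have hr' : ∀ᶠ n in atTop, |r n| < ε / 2 := by
    have := hr.abs
    rw [abs_zero] at this
    exact this.eventually_lt_const (half_pos hε)
  filter_upwards [hev, hMρ, hr'] with n h1 h2 h3
  refine (measure_mono fun ω hω => ?_).trans (h1.trans hη')
  change ε ≤ ‖Y n ω - c‖ at hω
  change M * ρ n < |R n ω|
  rw [hY, Real.norm_eq_abs, show c + R n ω + r n - c = R n ω + r n by ring] at hω
  have := abs_add_le (R n ω) (r n)
  linarith

end TrawlEstimator

end

theorem mainTheorem7 {Ω : Type*} [MeasurableSpace Ω] (P : Measure Ω) [IsProbabilityMeasure P]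
    (T : LevyTriplet) (L : Set (ℝ × ℝ) → Ω → ℝ) (hL : IsHomogeneousLevyBasis P T L)
    (κ : Measure ℝ) (hκ : IsLevySeedLaw T κ) (hmom : SeedMoments κ)
    (a φ : ℝ → ℝ) (ha : IsTrawlFunction a) (hφ : HasTrawlDensity a φ)
    (Δ : ℕ → ℝ) (μ : ℝ≥0∞) (hΔ : SamplingScheme Δ μ) (t : ℝ) (ht : 0 ≤ t) :
    DifferentiableWithinAt ℝ a (Set.Ici 0) t ∧
    (∃ (R : ℕ → Ω → ℝ) (r : ℕ → ℝ),
      (∀ n ω, derivEstimator (trawlProcess L a) (Δ n) n t ω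
        = derivWithin a (Set.Ici 0) t + R n ω + r n) ∧
      IsBigOInProbability P R (fun n => 1 / √(n * Δ n ^ 2)) ∧
      Tendsto r atTop (𝓝 0)) ∧
    (Tendsto (fun n : ℕ => n * Δ n ^ 2) atTop atTop →
      TendstoInMeasure P (fun n => derivEstimator (trawlProcess L a) (Δ n) n t) atTop
        (fun _ => derivWithin a (Set.Ici 0) t)) := by
  have hd := hφ.hasDerivWithinAt ht
  have hderiv : derivWithin a (Set.Ici 0) t = -φ t :=
    hd.derivWithin (uniqueDiffOn_Ici 0 t ht)
  have hR := hL.isBigOInProbability_derivEstimator hκ hmom ha hφ hΔ ht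
  have hr : Tendsto (fun n => derivEstimatorMean a (Δ n) n t - derivWithin a (Set.Ici 0) t)
      atTop (𝓝 0) := by
    rw [hderiv]
    simpa using (tendsto_derivEstimatorMean ha hφ hΔ ht).sub_const (-φ t)
  have hsplit : ∀ (n : ℕ) (ω : Ω), derivEstimator (trawlProcess L a) (Δ n) n t ω
      = derivWithin a (Set.Ici 0) t + (derivEstimator (trawlProcess L a) (Δ n) n t ω
        - derivEstimatorMean a (Δ n) n t)
        + (derivEstimatorMean a (Δ n) n t - derivWithin a (Set.Ici 0) t) := fun n ω => by ring
  refine ⟨hd.differentiableWithinAt, ⟨_, _, hsplit, hR, hr⟩, fun hn => ?_⟩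
  refine hR.tendstoInMeasure ?_ hr hsplit
  exact tendsto_const_nhds.div_atTop (Real.tendsto_sqrt_atTop.comp hn)
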